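/- Let $S$ be a closed connected oriented surface, $V\subset S$ a finite nonempty set, and let $\Delta$ be a triangulation of $S$ with vertex set $V$, edge set $E$ and set of triangles $T$ (loops, multiple edges and triangles glued to themselves are allowed). Let $\lambda\in\mathbb{R}^{E}$ and put $\ell_e=e^{\lambda_e/2}$ for $e\in E$. Let $(\Delta,\lambda)$ be Penner coordinates: they describe the complete finite area hyperbolic surface with cusps $V$, decorated with a horocycle at each cusp and ideally triangulated by $\Delta$, for which $\lambda_e$ is the signed distance of the horocycles at the two ends of (a lift of) the edge $e$. An ideal cell decomposition of a decorated surface is called *ideal Delaunay* if, after replacing all horocycles by horocycles at an equal distance closer to the cusps (distance $0$ allowed) so that they bound disjoint cusp neighborhoods, for every face of the lifted decomposition of $H^2$ there is a circle that touches all lifted horocycles centered at the vertices of this face externally and does not meet any other lifted horocycle. The triangulation $\Delta$ is an *ideal Delaunay triangulation* if it refines an ideal Delaunay decomposition, that is, if the edge set of the latter is a subset of $E$. If $\ell$ satisfies the strict triangle inequalities $\ell_{e_1}<\ell_{e_2}+\ell_{e_3}$, $\ell_{e_2}<\ell_{e_3}+\ell_{e_1}$, $\ell_{e_3}<\ell_{e_1}+\ell_{e_2}$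 for the sides $e_1,e_2,e_3$ of every triangle of $T$, let $(\Delta,\ell)$ be the surface $S$ with the piecewise euclidean metric that turns each triangle into a euclidean triangle and each edge $e$ into a line segment of length $\ell_e$. The triangulation $\Delta$ is a *Delaunay triangulation* of $(\Delta,\ell)$ if the circumdisk of every triangle is an immersed empty disk, that is, if unfolding the surface from this triangle over its open circumdisk one never meets a vertex in the open circumdisk. (i) If $\Delta$ is an ideal Delaunay triangulation of the decorated hyperbolic surface with Penner coordinates $(\Delta,\lambda)$, then $\ell$ satisfies the strict triangle inequalities for every triangle, and $\Delta$ is a Delaunay triangulation of the piecewise euclidean surface $(\Delta,\ell)$. (ii) Conversely, if $\ell$ satisfies the strict triangle inequalities for every triangle and $\Delta$ is a Delaunay triangulation of the piecewise euclidean surface $(\Delta,\ell)$, then $\Delta$ is an ideal Delaunay triangulation of the decorated hyperbolic surface with Penner coordinates $(\Delta,\lambda)$. -/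

import Mathlib

/-! ## Triangulated closed oriented surfaces -/

/-- A triangulation of a closed connected oriented surface `S` with vertex set `V` (loops, multiple
edges and self-glued triangles are allowed), given by its set `T` of triangles and the gluing of
their sides. Every triangle has corners `0, 1, 2` in positive cyclic order, and the side `(t, i)`
is the side of `t` opposite to corner `i`; it joins the corners `i + 1` and `i + 2`. If
`glue (t, i) = (t', j)`, then these two sides are identified so that corner `i + 1` of `t` matches
corner `j + 2` of `t'` and corner `i + 2` of `t` matches corner `j + 1` of `t'`. -/
structure Triangulation (T : Type*) where
  glue : T × Fin 3 → T × Fin 3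
  glue_glue : ∀ d, glue (glue d) = d
  glue_ne : ∀ d, glue d ≠ d
  connected : ∀ t t' : T,
    Relation.ReflTransGen (fun a b => ∃ i, (glue (a, i)).1 = b) t t'

namespace Triangulation

variable {T : Type*} (Δ : Triangulation T)

/-- The edges of the triangulation: sides of triangles up to gluing. -/
def Edge : Type _ := Quot (fun d d' : T × Fin 3 => Δ.glue d = d')

/-- The edge of the triangulation on which side `i` of the triangle `t` lies. -/
def edge (t : T) (i : Fin 3) : Δ.Edge := Quot.mk _ (t, i)

variable {Δ}

/-- `ℓ = exp (λ / 2)`. -/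
noncomputable def ell (lam : Δ.Edge → ℝ) : Δ.Edge → ℝ := fun e => Real.exp (lam e / 2)

/-- The strict triangle inequalities for every triangle. -/
def TriangleInequalities (ℓ : Δ.Edge → ℝ) : Prop :=
  ∀ (t : T) (i : Fin 3),
    ℓ (Δ.edge t i) < ℓ (Δ.edge t (i + 1)) + ℓ (Δ.edge t (i + 2))

end Triangulation

/-! ## Horocycles in the hyperbolic plane -/

namespace Hyp

/-- The determinant of two vectors of `ℝ²`. -/
def det (v w : ℝ × ℝ) : ℝ := v.1 * w.2 - v.2 * w.1

/-- A nonzero vector `v = (a, b)` of `ℝ²` encodes a horocycle of the upper half plane `ℍ`: if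
`b ≠ 0`, the euclidean circle of diameter `1 / b ^ 2` touching the real line at `a / b`, and if
`b = 0`, the horizontal line at height `a ^ 2`. Each horocycle is encoded by exactly two vectors,
`v` and `-v`. The signed distance of the horocycles encoded by `v` and `w` (negative if they
intersect) is `λ = 2 * log |det v w|`, that is `|det v w| = exp (λ / 2)`.

`signedDist v z` is the signed hyperbolic distance of the point `z` from the horocycle encoded by
`v`, negative inside the horodisk. -/
noncomputable def signedDist (v : ℝ × ℝ) (z : UpperHalfPlane) : ℝ :=
  Real.log (Complex.normSq ((v.2 : ℂ) * (z : ℂ) - (v.1 : ℂ)) / z.im)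

/-- The horocycle encoded by `v`, moved by the distance `s` towards its center. -/
def horocycle (v : ℝ × ℝ) (s : ℝ) : Set UpperHalfPlane := {z | signedDist v z = -s}

/-- The open horodisk bounded by `horocycle v s`. -/
def horodisk (v : ℝ × ℝ) (s : ℝ) : Set UpperHalfPlane := {z | signedDist v z < -s}

/-- The hyperbolic circle with center `c` and radius `r` touches `horocycle v s` externally: the
closed disk and the closed horodisk have exactly one point in common. -/
def TouchesExternally (c : UpperHalfPlane) (r : ℝ) (v : ℝ × ℝ) (s : ℝ) : Prop :=
  ∃ p, Metric.closedBall c r ∩ (horodisk v s ∪ horocycle v s) = {p}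

end Hyp

namespace Triangulation

variable {T : Type*} {Δ : Triangulation T}

/-! ## The decorated hyperbolic surface with Penner coordinates `(Δ, λ)`

The surface is glued from decorated ideal triangles. Its universal cover is the hyperbolic plane,
tiled by the lifts of these triangles. The lifts are obtained from one decorated ideal triangle in
the plane by repeatedly attaching the neighboring triangles (developing). -/

/-- A triangle `tri` of `Δ` placed in the hyperbolic plane as a positively oriented ideal triangle
decorated with horocycles (`vec i` encodes the horocycle at corner `i`) whose signed distances
along the sides are the given `λ`. -/
structure IdealTriangle (lam : Δ.Edge → ℝ) where
  tri : T
  vec : Fin 3 → ℝ × ℝ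
  det_eq : ∀ i, Hyp.det (vec (i + 1)) (vec (i + 2)) = ell lam (Δ.edge tri i)

/-- `τ` is the neighbor of `σ` across the side `i` of `σ`: its underlying triangle is the one glued
to this side, and `σ` and `τ` have the decorated side in common, on whose two different sides they
lie. (The sign keeps both determinants positive; it does not affect the horocycle.) -/
def IdealTriangle.Adj {lam : Δ.Edge → ℝ} (σ : IdealTriangle lam) (i : Fin 3)
    (τ : IdealTriangle lam) : Prop :=
  ∃ j, Δ.glue (σ.tri, i) = (τ.tri, j) ∧
    τ.vec (j + 1) = σ.vec (i + 2) ∧ τ.vec (j + 2) = -σ.vec (i + 1)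

/-- `σ` is one of the triangles of the lifted triangulation, the lift being fixed by the position
`σ₀` of one of its triangles. -/
def IsLift {lam : Δ.Edge → ℝ} (σ₀ σ : IdealTriangle lam) : Prop :=
  Relation.ReflTransGen (fun a b => ∃ i, a.Adj i b) σ₀ σ

/-- The lifted horocycles, moved by the distance `s` towards their centers. -/
def liftedHorocycles {lam : Δ.Edge → ℝ} (σ₀ : IdealTriangle lam) (s : ℝ) :
    Set (Set UpperHalfPlane) :=
  {h | ∃ σ k, IsLift σ₀ σ ∧ h = Hyp.horocycle (σ.vec k) s}

/-- The horocycles, moved by the distance `s` towards the cusps, bound disjoint cusp neighborhoods: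
the horodisks of different lifted horocycles are disjoint. -/
def DisjointCuspNeighborhoods {lam : Δ.Edge → ℝ} (σ₀ : IdealTriangle lam) (s : ℝ) : Prop :=
  ∀ σ k σ' k', IsLift σ₀ σ → IsLift σ₀ σ' →
    Hyp.horocycle (σ.vec k) s ≠ Hyp.horocycle (σ'.vec k') s →
    Disjoint (Hyp.horodisk (σ.vec k) s) (Hyp.horodisk (σ'.vec k') s)

/-- For a set `D` of edges of `Δ`, consider the decomposition of the surface obtained from `Δ` by
erasing the edges not in `D`. The triangle `τ` lies in the same face of its lift as `σ`. -/
def SameFace {lam : Δ.Edge → ℝ} (D : Set Δ.Edge) (σ τ : IdealTriangle lam) : Prop :=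
  Relation.ReflTransGen (fun a b => ∃ i, Δ.edge a.tri i ∉ D ∧ a.Adj i b) σ τ

/-- The (moved) lifted horocycles centered at the vertices of the lifted face that contains `σ`. -/
def faceHorocycles {lam : Δ.Edge → ℝ} (D : Set Δ.Edge) (σ : IdealTriangle lam) (s : ℝ) :
    Set (Set UpperHalfPlane) :=
  {h | ∃ τ k, SameFace D σ τ ∧ h = Hyp.horocycle (τ.vec k) s}

/-- The global Delaunay condition for the decomposition with edge set `D` and the horocycles moved
by the distance `s` towards the cusps: for every lifted face there is a circle that touches all
lifted horocycles centered at the vertices of the face externally and does not meet any other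
lifted horocycle. -/
def GlobalDelaunay {lam : Δ.Edge → ℝ} (σ₀ : IdealTriangle lam) (D : Set Δ.Edge) (s : ℝ) : Prop :=
  ∀ σ, IsLift σ₀ σ → ∃ (c : UpperHalfPlane) (r : ℝ), 0 < r ∧
    (∀ τ k, SameFace D σ τ → Hyp.TouchesExternally c r (τ.vec k) s) ∧
    (∀ h ∈ liftedHorocycles σ₀ s, h ∉ faceHorocycles D σ s → Disjoint (Metric.sphere c r) h)

/-- The decomposition with edge set `D ⊆ E_Δ` is the ideal Delaunay decomposition of the decorated
surface with Penner coordinates `(Δ, λ)`: the global Delaunay condition holds after replacing the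
horocycles by horocycles at equal distance `s ≥ 0` that bound disjoint cusp neighborhoods. (A circle
touches only finitely many disjoint horodisks, so the global condition forces the lifted faces to be
ideal polygons. The choices of `σ₀` and of the admissible `s` do not matter.) -/
def IsIdealDelaunayDecomposition (lam : Δ.Edge → ℝ) (D : Set Δ.Edge) : Prop :=
  ∃ (σ₀ : IdealTriangle lam) (s : ℝ), 0 ≤ s ∧
    DisjointCuspNeighborhoods σ₀ s ∧ GlobalDelaunay σ₀ D s

/-- `Δ` is an ideal Delaunay triangulation of the decorated surface with Penner coordinates
`(Δ, λ)`: it refines the ideal Delaunay decomposition. -/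
def IsIdealDelaunay (lam : Δ.Edge → ℝ) : Prop :=
  ∃ D : Set Δ.Edge, IsIdealDelaunayDecomposition lam D

/-! ## The piecewise euclidean surface `(Δ, ℓ)` -/

/-- A triangle `tri` of `Δ` placed in the euclidean plane as a positively oriented triangle with
side lengths `ℓ`. -/
structure EuclideanTriangle (ℓ : Δ.Edge → ℝ) where
  tri : T
  pt : Fin 3 → ℂ
  dist_eq : ∀ i, dist (pt (i + 1)) (pt (i + 2)) = ℓ (Δ.edge tri i)
  oriented : 0 < ((starRingEnd ℂ) (pt 1 - pt 0) * (pt 2 - pt 0)).im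

/-- `τ` is the triangle glued to the side `i` of `σ`, unfolded into the plane of `σ`. -/
def EuclideanTriangle.Adj {ℓ : Δ.Edge → ℝ} (σ : EuclideanTriangle ℓ) (i : Fin 3)
    (τ : EuclideanTriangle ℓ) : Prop :=
  ∃ j, Δ.glue (σ.tri, i) = (τ.tri, j) ∧
    τ.pt (j + 1) = σ.pt (i + 2) ∧ τ.pt (j + 2) = σ.pt (i + 1)

/-- `τ` is reached from `σ` by unfolding the surface over the open disk with center `c` and radius
`r`, that is, by successively unfolding triangles across sides that meet this disk. -/
def UnfoldsOver {ℓ : Δ.Edge → ℝ} (c : ℂ) (r : ℝ) (σ τ : EuclideanTriangle ℓ) : Prop :=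
  Relation.ReflTransGen
    (fun a b => ∃ i, (segment ℝ (a.pt (i + 1)) (a.pt (i + 2)) ∩ Metric.ball c r).Nonempty ∧
      a.Adj i b) σ τ

/-- The circumdisk of `σ` is an immersed empty disk of the piecewise euclidean surface: unfolding
the surface over the open circumdisk, one never meets a vertex in it. (Then the unfolding maps the
open circumdisk by a local isometry to the surface without its vertices, extending the inclusion of
the triangle. If instead one meets a vertex, there is no such map.) -/
def EmptyCircumdisk {ℓ : Δ.Edge → ℝ} (σ : EuclideanTriangle ℓ) : Prop :=
  ∃ (c : ℂ) (r : ℝ), (∀ k, dist (σ.pt k) c = r) ∧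
    ∀ τ k, UnfoldsOver c r σ τ → τ.pt k ∉ Metric.ball c r

/-- `Δ` is a Delaunay triangulation of the piecewise euclidean surface `(Δ, ℓ)`: the circumdisk of
every triangle is an immersed empty disk. -/
def IsEuclideanDelaunay (ℓ : Δ.Edge → ℝ) : Prop :=
  ∀ t : T, ∃ σ : EuclideanTriangle ℓ, σ.tri = t ∧ EmptyCircumdisk σ

end Triangulation

/-!
A horocycle is a vector `v` of the plane up to sign, and a point `c` of the hyperbolic plane is a
positive definite quadratic form of determinant `1`, whose logarithm at `v` is the signed distance
of `c` from the horocycle. Hence a circle touches the three horocycles of a triangle if and only if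
the form of its center is constant on the three vectors, that is, if it is a multiple of the form
`circumForm` obtained from them by Lagrange interpolation; this form is positive definite if and
only if the numbers `ℓ` satisfy the triangle inequalities.

Both Delaunay conditions are equivalent to the same local condition `0 ≤ cos α + cos β` on the
angles opposite to each edge in the euclidean triangles with sides `ℓ`. Across an edge, the
circumscribed form changes by a positive multiple of `(cos α + cos β) * det v₁ w * det v₂ w`, where
`v₁`, `v₂` are the vectors on the edge, and the power of a point with respect to the euclidean
circumcircle changes by `cot α + cot β` times the oriented distance from the edge, up to a positive
factor. The local condition makes both quantities decrease on the far side of every edge, and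
iterating this along a path of triangles that never turns back shows that no horocycle or vertex
lies inside a circumscribed circle.
-/

/-! ### Horocycles and quadratic forms -/

namespace Hyp

open UpperHalfPlane

theorem det_self (v : ℝ × ℝ) : det v v = 0 := by
  unfold det; ring

theorem det_swap (v w : ℝ × ℝ) : det w v = -det v w := by
  unfold det; ring

theorem det_neg_left (v w : ℝ × ℝ) : det (-v) w = -det v w := by
  simp only [det, Prod.fst_neg, Prod.snd_neg]; ring

theorem det_neg_right (v w : ℝ × ℝ) : det v (-w) = -det v w := by
  simp only [det, Prod.fst_neg, Prod.snd_neg]; ring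

theorem eq_of_det_eq {u v w w' : ℝ × ℝ} (huv : det u v ≠ 0) (hu : det u w = det u w')
    (hv : det v w = det v w') : w = w' := by
  unfold det at *
  ext <;> apply mul_left_cancel₀ huv
  · linear_combination v.1 * hu - u.1 * hv
  · linear_combination v.2 * hu - u.2 * hv

theorem exists_det_eq_one {v : ℝ × ℝ} (hv : v ≠ 0) : ∃ u, det v u = 1 := by
  have hnorm : v.1 ^ 2 + v.2 ^ 2 ≠ 0 := fun h => hv (Prod.ext
    (by change v.1 = 0; nlinarith [sq_nonneg v.1, sq_nonneg v.2])
    (by change v.2 = 0; nlinarith [sq_nonneg v.1, sq_nonneg v.2]))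
  refine ⟨(-v.2 / (v.1 ^ 2 + v.2 ^ 2), v.1 / (v.1 ^ 2 + v.2 ^ 2)), ?_⟩
  simp only [det]
  field_simp
  ring

/-- The positive definite quadratic form attached to a point `z` of the hyperbolic plane. Its
logarithm at `v` is the signed distance of `z` from the horocycle encoded by `v`. -/
noncomputable def horoForm (z : ℍ) (v : ℝ × ℝ) : ℝ :=
  Complex.normSq ((v.2 : ℂ) * (z : ℂ) - (v.1 : ℂ)) / z.im

theorem signedDist_eq_log_horoForm (v : ℝ × ℝ) (z : ℍ) :
    signedDist v z = Real.log (horoForm z v) := rfl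

theorem horoForm_eq (z : ℍ) (v : ℝ × ℝ) :
    horoForm z v = ((v.2 * z.re - v.1) ^ 2 + (v.2 * z.im) ^ 2) / z.im := by
  simp [horoForm, Complex.normSq_apply, sq]

theorem horoForm_neg (z : ℍ) (v : ℝ × ℝ) : horoForm z (-v) = horoForm z v := by
  simp only [horoForm_eq, Prod.fst_neg, Prod.snd_neg]; ring

theorem horoForm_pos (z : ℍ) {v : ℝ × ℝ} (hv : v ≠ 0) : 0 < horoForm z v := by
  refine div_pos (Complex.normSq_pos.2 fun h => hv ?_) z.im_pos
  have hsnd : v.2 = 0 := by simpa [z.im_ne_zero] using congrArg Complex.im h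
  exact Prod.ext (by simpa [hsnd] using h) hsnd

theorem signedDist_eq_iff (z : ℍ) {v : ℝ × ℝ} (hv : v ≠ 0) (t : ℝ) :
    signedDist v z = t ↔ horoForm z v = Real.exp t := by
  rw [signedDist_eq_log_horoForm]
  exact ⟨fun h => h ▸ (Real.exp_log (horoForm_pos z hv)).symm, fun h => h ▸ Real.log_exp t⟩

theorem det_sq_le_horoForm_mul (z : ℍ) (v w : ℝ × ℝ) :
    det v w ^ 2 ≤ horoForm z v * horoForm z w := by
  have := z.im_pos
  rw [horoForm_eq, horoForm_eq, div_mul_div_comm, le_div_iff₀ (by positivity), det]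
  nlinarith [sq_nonneg ((v.2 * z.re - v.1) * (w.2 * z.re - w.1) + v.2 * w.2 * z.im ^ 2)]

/-- Lagrange interpolation: a quadratic form on the plane is determined by its values at three
vectors. -/
theorem det_mul_horoForm (z : ℍ) (a b c w : ℝ × ℝ) :
    det b c * det c a * det a b * horoForm z w =
      -(det b c * horoForm z a * (det b w * det c w) +
        det c a * horoForm z b * (det c w * det a w) +
          det a b * horoForm z c * (det a w * det b w)) := by
  have := z.im_ne_zero
  simp only [horoForm_eq, det]
  field_simp
  ring

theorem exists_det_mul_horoForm_eq {a b : ℝ × ℝ} (hab : 0 < det a b) :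
    ∃ z : ℍ, ∀ w, det a b * horoForm z w = det a w ^ 2 + det b w ^ 2 := by
  have hnorm : 0 < a.2 ^ 2 + b.2 ^ 2 := by
    by_contra! h
    have ha : a.2 = 0 := by nlinarith [sq_nonneg a.2, sq_nonneg b.2]
    have hb : b.2 = 0 := by nlinarith [sq_nonneg a.2, sq_nonneg b.2]
    simp [det, ha, hb] at hab
  -- The root `(b.1 + i a.1) / (b.2 + i a.2)` of the quadratic polynomial `det a w² + det b w²`.
  refine ⟨⟨⟨(a.1 * a.2 + b.1 * b.2) / (a.2 ^ 2 + b.2 ^ 2), det a b / (a.2 ^ 2 + b.2 ^ 2)⟩,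
    div_pos hab hnorm⟩, fun w => ?_⟩
  rw [horoForm_eq]
  simp only [UpperHalfPlane.re, UpperHalfPlane.im]
  have := hab.ne'
  field_simp
  simp only [det]
  ring

theorem exists_isometryEquiv_signedDist_eq {v : ℝ × ℝ} (hv : v ≠ 0) :
    ∃ φ : ℍ ≃ᵢ ℍ, ∀ z, signedDist v z = -Real.log (φ z).im := by
  obtain ⟨u, hu⟩ := exists_det_eq_one hv
  let g : Matrix.SpecialLinearGroup (Fin 2) ℝ :=
    ⟨!![u.2, -u.1; -v.2, v.1], by rw [Matrix.det_fin_two_of, ← hu, det]; ring⟩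
  refine ⟨IsometryEquiv.constSMul g, fun z => ?_⟩
  have him : (g • z).im = z.im / Complex.normSq ((v.2 : ℂ) * z - v.1) := by
    have hdenom : (g 1 0 : ℂ) * z + g 1 1 = -((v.2 : ℂ) * z - v.1) := by
      change ((-v.2 : ℝ) : ℂ) * z + (v.1 : ℂ) = _
      push_cast
      ring
    rw [← Complex.normSq_neg, ← hdenom, MulAction.compHom_smul_def, im_smul_eq_div_normSq]
    simp [denom]
  rw [IsometryEquiv.constSMul_apply, him, ← Real.log_inv, inv_div]
  rfl

theorem abs_signedDist_sub_le {v : ℝ × ℝ} (hv : v ≠ 0) (z w : ℍ) :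
    |signedDist v z - signedDist v w| ≤ dist z w := by
  obtain ⟨φ, hφ⟩ := exists_isometryEquiv_signedDist_eq hv
  rw [hφ, hφ, ← φ.dist_eq z w, neg_sub_neg, abs_sub_comm]
  exact dist_log_im_le _ _

theorem continuous_signedDist {v : ℝ × ℝ} (hv : v ≠ 0) : Continuous (signedDist v) :=
  (LipschitzWith.mk_one (abs_signedDist_sub_le hv)).continuous

theorem exists_dist_eq_abs_signedDist_eq {v : ℝ × ℝ} (hv : v ≠ 0) (z : ℍ) (t : ℝ) :
    ∃ w, dist w z = |t| ∧ signedDist v w = signedDist v z - t := by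
  obtain ⟨φ, hφ⟩ := exists_isometryEquiv_signedDist_eq hv
  let p : ℍ := ⟨⟨(φ z).re, (φ z).im * Real.exp t⟩, mul_pos (φ z).im_pos (Real.exp_pos t)⟩
  have hlog : Real.log p.im = Real.log (φ z).im + t := by
    change Real.log ((φ z).im * Real.exp t) = _
    rw [Real.log_mul (φ z).im_ne_zero (Real.exp_ne_zero t), Real.log_exp]
  refine ⟨φ.symm p, ?_, ?_⟩
  · rw [← φ.dist_eq, φ.apply_symm_apply, dist_of_re_eq (z := p) (w := φ z) rfl, Real.dist_eq,
      hlog, add_sub_cancel_left]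
  · rw [hφ, hφ, φ.apply_symm_apply, hlog, neg_add']

theorem coe_eq_of_dist_le_of_le_im {z p : ℍ} {t : ℝ} (hdist : dist p z ≤ t)
    (him : z.im * Real.exp t ≤ p.im) : (p : ℂ) = ⟨z.re, z.im * Real.exp t⟩ := by
  rw [dist_le_iff_dist_coe_center_le, Complex.dist_eq] at hdist
  have hsub : ((p : ℂ) - (z.center t : ℂ)).im = p.im - z.im * Real.cosh t := by
    simp
  have hle := (le_abs_self _).trans (Complex.abs_im_le_norm ((p : ℂ) - (z.center t : ℂ)))
  rw [hsub] at hle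
  rw [← Real.cosh_add_sinh, mul_add] at him ⊢
  -- The highest point of a circle is the only one at its height.
  have hre := Complex.abs_im_eq_norm.1 (le_antisymm (Complex.abs_im_le_norm _)
    (hdist.trans ((le_sub_iff_add_le'.2 him).trans (hsub ▸ le_abs_self _))))
  exact Complex.ext (by simpa [sub_eq_zero] using hre)
    (le_antisymm (by simpa using sub_le_iff_le_add'.1 (hle.trans hdist)) him)

theorem eq_of_dist_le_of_signedDist_le {v : ℝ × ℝ} (hv : v ≠ 0) {z p q : ℍ} {t : ℝ}
    (hp : dist p z ≤ t) (hp' : signedDist v p ≤ signedDist v z - t)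
    (hq : dist q z ≤ t) (hq' : signedDist v q ≤ signedDist v z - t) : p = q := by
  obtain ⟨φ, hφ⟩ := exists_isometryEquiv_signedDist_eq hv
  have heq {p : ℍ} (hp : dist p z ≤ t) (hp' : signedDist v p ≤ signedDist v z - t) :
      (φ p : ℂ) = ⟨(φ z).re, (φ z).im * Real.exp t⟩ := by
    refine coe_eq_of_dist_le_of_le_im (φ.dist_eq p z ▸ hp) ?_
    rw [hφ, hφ] at hp'
    rw [← Real.log_le_log_iff (mul_pos (φ z).im_pos (Real.exp_pos t)) (φ p).im_pos,
      Real.log_mul (φ z).im_ne_zero (Real.exp_ne_zero t), Real.log_exp]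
    linarith
  exact φ.injective (UpperHalfPlane.ext ((heq hp hp').trans (heq hq hq').symm))

theorem isPreconnected_sphere (c : ℍ) (r : ℝ) : IsPreconnected (Metric.sphere c r) := by
  rw [← isOpenEmbedding_coe.isInducing.isPreconnected_image, image_coe_sphere]
  exact _root_.isPreconnected_sphere (by simp [Complex.rank_real_complex]) _ _

theorem mem_closedBall_inter_iff {c q : ℍ} {r s : ℝ} {v : ℝ × ℝ} :
    q ∈ Metric.closedBall c r ∩ (horodisk v s ∪ horocycle v s) ↔
      dist q c ≤ r ∧ signedDist v q ≤ -s := by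
  rw [Set.mem_inter_iff, Metric.mem_closedBall, le_iff_lt_or_eq (a := signedDist v q)]
  rfl

theorem touchesExternally_of_signedDist_eq {c : ℍ} {r : ℝ} {v : ℝ × ℝ} {s : ℝ} (hv : v ≠ 0)
    (hr : 0 ≤ r) (h : signedDist v c = r - s) : TouchesExternally c r v s := by
  obtain ⟨p, hpdist, hp⟩ := exists_dist_eq_abs_signedDist_eq hv c r
  rw [abs_of_nonneg hr] at hpdist
  refine ⟨p, Set.eq_singleton_iff_unique_mem.2
    ⟨mem_closedBall_inter_iff.2 ⟨hpdist.le, by linarith⟩, fun q hq => ?_⟩⟩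
  obtain ⟨hqdist, hq⟩ := mem_closedBall_inter_iff.1 hq
  exact eq_of_dist_le_of_signedDist_le hv hqdist (by linarith) hpdist.le (by linarith)

theorem TouchesExternally.signedDist_eq {c : ℍ} {r : ℝ} {v : ℝ × ℝ} {s : ℝ} (hv : v ≠ 0)
    (hr : 0 < r) (h : TouchesExternally c r v s) : signedDist v c = r - s := by
  obtain ⟨p, hp⟩ := h
  obtain ⟨hpdist, hps⟩ := mem_closedBall_inter_iff.1 (hp.symm ▸ Set.mem_singleton p)
  have hunique {q : ℍ} (hqdist : dist q c ≤ r) (hq : signedDist v q ≤ -s) : q = p :=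
    (Set.ext_iff.1 hp q).1 (mem_closedBall_inter_iff.2 ⟨hqdist, hq⟩)
  have hle := (le_abs_self _).trans (abs_signedDist_sub_le hv c p)
  rw [dist_comm] at hle
  refine le_antisymm (by linarith) (not_lt.1 fun hlt => ?_)
  -- Otherwise the points at distances `t < r` and `r` on the ray towards the cusp both lie in the
  -- intersection.
  let t := max 0 (signedDist v c + s)
  have ht : 0 ≤ t := le_max_left _ _
  have htr : t < r := max_lt hr (by linarith)
  have hts : signedDist v c + s ≤ t := le_max_right _ _
  obtain ⟨q, hqdist, hq⟩ := exists_dist_eq_abs_signedDist_eq hv c t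
  obtain ⟨q', hqdist', hq'⟩ := exists_dist_eq_abs_signedDist_eq hv c r
  rw [abs_of_nonneg ht] at hqdist
  rw [abs_of_pos hr] at hqdist'
  rw [hunique (q := q) (by linarith) (by linarith)] at hqdist
  rw [hunique (q := q') (by linarith) (by linarith)] at hqdist'
  exact htr.ne (hqdist.symm.trans hqdist')

theorem disjoint_sphere_horocycle {c : ℍ} {r : ℝ} {v : ℝ × ℝ} {s : ℝ} (hv : v ≠ 0)
    (h : r - s < signedDist v c) : Disjoint (Metric.sphere c r) (horocycle v s) := by
  refine Set.disjoint_left.2 fun z (hz : dist z c = r) (hzv : signedDist v z = -s) => ?_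
  have hle := (le_abs_self _).trans (abs_signedDist_sub_le hv c z)
  rw [dist_comm] at hle
  linarith

theorem lt_or_lt_of_disjoint_sphere_horocycle {c : ℍ} {r : ℝ} {v : ℝ × ℝ} {s : ℝ} (hv : v ≠ 0)
    (h : Disjoint (Metric.sphere c r) (horocycle v s)) :
    r - s < signedDist v c ∨ signedDist v c < -r - s := by
  by_contra! hc
  obtain ⟨p, hpdist, hp⟩ := exists_dist_eq_abs_signedDist_eq hv c r
  obtain ⟨q, hqdist, hq⟩ := exists_dist_eq_abs_signedDist_eq hv c (-r)
  rw [abs_of_nonneg (by linarith)] at hpdist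
  rw [abs_neg, abs_of_nonneg (by linarith)] at hqdist
  obtain ⟨z, hz, hzs⟩ := (isPreconnected_sphere c r).intermediate_value hpdist hqdist
    (continuous_signedDist hv).continuousOn
    (show -s ∈ Set.Icc _ _ from ⟨by linarith, by linarith⟩)
  exact Set.disjoint_left.1 h hz hzs

/-- A circle touching one of two disjoint horodisks externally is not contained in the other. -/
theorem le_signedDist_of_disjoint_horodisk {c : ℍ} {r : ℝ} {v w : ℝ × ℝ} {s : ℝ} (hv : v ≠ 0)
    (hw : w ≠ 0) (hr : 0 ≤ r) (hc : signedDist v c = r - s)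
    (h : Disjoint (horodisk v s) (horodisk w s)) : -r - s ≤ signedDist w c := by
  by_contra! hlt
  obtain ⟨ε, hε, hlt⟩ : ∃ ε > 0, signedDist w c + ε < -r - s - ε :=
    ⟨(-r - s - signedDist w c) / 3, by linarith, by linarith⟩
  obtain ⟨p, hpdist, hp⟩ := exists_dist_eq_abs_signedDist_eq hv c (r + ε)
  rw [abs_of_nonneg (by linarith)] at hpdist
  have hle := (le_abs_self _).trans (abs_signedDist_sub_le hw p c)
  exact Set.disjoint_left.1 h (show signedDist v p < -s by linarith)
    (show signedDist w p < -s by linarith)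

theorem disjoint_horodisk {v w : ℝ × ℝ} {s : ℝ} (hv : v ≠ 0) (hw : w ≠ 0)
    (h : Real.exp (-s) ≤ |det v w|) : Disjoint (horodisk v s) (horodisk w s) := by
  refine Set.disjoint_left.2 fun z (hzv : signedDist v z < -s) (hzw : signedDist w z < -s) => ?_
  rw [signedDist_eq_log_horoForm, Real.log_lt_iff_lt_exp (horoForm_pos z ‹_›)] at hzv hzw
  refine absurd (det_sq_le_horoForm_mul z v w) (not_le.2 ?_)
  calc horoForm z v * horoForm z w < Real.exp (-s) * Real.exp (-s) :=
        mul_lt_mul'' hzv hzw (horoForm_pos z hv).le (horoForm_pos z hw).le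
    _ ≤ |det v w| * |det v w| := mul_self_le_mul_self (Real.exp_pos _).le h
    _ = det v w ^ 2 := by rw [abs_mul_abs_self, sq]

theorem horocycle_neg (v : ℝ × ℝ) (s : ℝ) : horocycle (-v) s = horocycle v s := by
  simp only [horocycle, signedDist_eq_log_horoForm, horoForm_neg]

theorem eq_or_eq_neg_of_horocycle_eq {v w : ℝ × ℝ} {s : ℝ} (hv : v ≠ 0) (hw : w ≠ 0)
    (h : horocycle v s = horocycle w s) : w = v ∨ w = -v := by
  obtain ⟨u, hu⟩ := exists_det_eq_one hv
  set t := Real.exp (-s)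
  have ht0 : 0 < t := Real.exp_pos _
  have hform (x : ℝ) : t ^ 2 = det v w ^ 2 + t ^ 2 * (det u w + x * det v w) ^ 2 := by
    have hdet (w) : det (t * (u.1 + x * v.1), t * (u.2 + x * v.2)) w =
        t * (det u w + x * det v w) := by simp only [det]; ring
    have hvu : det v (t * (u.1 + x * v.1), t * (u.2 + x * v.2)) = t := by
      rw [← neg_eq_iff_eq_neg.2 (det_swap _ _), hdet, det_self, det_swap v u, hu]; ring
    obtain ⟨z, hz⟩ := exists_det_mul_horoForm_eq (hvu.symm ▸ ht0)
    simp only [hvu, hdet] at hz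
    have hzv : horoForm z v = t := by
      have hzv := hz v
      rw [det_self, det_swap v u, hu] at hzv
      exact mul_left_cancel₀ ht0.ne' (by linarith)
    have hzw : z ∈ horocycle w s := h ▸ (signedDist_eq_iff z hv _).2 hzv
    have hzw := hz w ▸ congrArg (t * ·) ((signedDist_eq_iff z hw _).1 hzw)
    linarith
  have hdet : det v w = 0 := by
    have := hform 0
    have := hform 1
    have := hform (-1)
    refine pow_eq_zero_iff two_ne_zero |>.1 ((mul_eq_zero.1 ?_).resolve_left (pow_pos ht0 2).ne')
    linarith
  have hdet' : det u w ^ 2 = 1 := by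
    have := hform 0
    simp only [hdet] at this
    exact mul_left_cancel₀ (pow_pos ht0 2).ne' (by linarith)
  have hvu : det v u ≠ 0 := hu ▸ one_ne_zero
  rcases sq_eq_one_iff.1 hdet' with h | h
  · exact .inr (eq_of_det_eq hvu (by rw [hdet, det_neg_right, det_self, neg_zero])
      (by rw [h, det_neg_right, det_swap v u, hu, neg_neg]))
  · exact .inl (eq_of_det_eq hvu (by rw [hdet, det_self]) (by rw [h, det_swap v u, hu]))

end Hyp

/-! ### Angles and the local Delaunay condition -/

theorem fin_three_add_add (i : Fin 3) :
    i + 1 + 1 = i + 2 ∧ i + 1 + 2 = i ∧ i + 2 + 1 = i ∧ i + 2 + 2 = i + 1 := by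
  decide +revert

theorem forall_fin_three {P : Fin 3 → Prop} (i : Fin 3) :
    (∀ k, P k) ↔ P i ∧ P (i + 1) ∧ P (i + 2) := by
  have hcases : ∀ i k : Fin 3, k = i ∨ k = i + 1 ∨ k = i + 2 := by decide
  refine ⟨fun h => ⟨h _, h _, h _⟩, fun ⟨h, h1, h2⟩ k => ?_⟩
  obtain rfl | rfl | rfl := hcases i k
  exacts [h, h1, h2]

theorem exists_fin_three {X : Type*} (i : Fin 3) (x y z : X) :
    ∃ f : Fin 3 → X, f i = x ∧ f (i + 1) = y ∧ f (i + 2) = z :=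
  ⟨fun k => ![x, y, z] (k - i), by simp⟩

@[to_additive]
theorem prod_fin_three {M : Type*} [CommMonoid M] (f : Fin 3 → M) (i : Fin 3) :
    ∏ k, f k = f i * f (i + 1) * f (i + 2) := by
  rw [← Equiv.prod_comp (Equiv.addLeft i), Fin.prod_univ_three]
  simp

namespace Triangulation

variable {T : Type*} {Δ : Triangulation T}

theorem ell_pos (lam : Δ.Edge → ℝ) (e : Δ.Edge) : 0 < ell lam e := Real.exp_pos _

theorem edge_eq_of_glue {t t' : T} {i j : Fin 3} (h : Δ.glue (t, i) = (t', j)) :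
    Δ.edge t' j = Δ.edge t i :=
  (Quot.sound (r := fun d d' => Δ.glue d = d') h).symm

/-- The cosine of the angle opposite to the side `d` of a triangle with side lengths `ℓ`. -/
noncomputable def cornerCos (ℓ : Δ.Edge → ℝ) (d : T × Fin 3) : ℝ :=
  (ℓ (Δ.edge d.1 (d.2 + 1)) ^ 2 + ℓ (Δ.edge d.1 (d.2 + 2)) ^ 2 - ℓ (Δ.edge d.1 d.2) ^ 2) /
    (2 * ℓ (Δ.edge d.1 (d.2 + 1)) * ℓ (Δ.edge d.1 (d.2 + 2)))

/-- The local Delaunay condition: the two angles opposite to every edge add up to at most `π`.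
It is expressed through `cos α + cos β = 2 cos ((α + β) / 2) cos ((α - β) / 2)`. -/
def LocallyDelaunay (ℓ : Δ.Edge → ℝ) : Prop :=
  ∀ d, 0 ≤ cornerCos ℓ d + cornerCos ℓ (Δ.glue d)

/-- The edges whose opposite angles add up to less than `π`. -/
def essentialEdges (ℓ : Δ.Edge → ℝ) : Set Δ.Edge :=
  {e | Quot.lift (fun d => 0 < cornerCos ℓ d + cornerCos ℓ (Δ.glue d))
    (fun d d' h => by subst h; rw [Δ.glue_glue, add_comm]) e}

theorem edge_mem_essentialEdges {ℓ : Δ.Edge → ℝ} {t : T} {i : Fin 3} :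
    Δ.edge t i ∈ essentialEdges ℓ ↔ 0 < cornerCos ℓ (t, i) + cornerCos ℓ (Δ.glue (t, i)) :=
  Iff.rfl

theorem two_mul_mul_cornerCos {ℓ : Δ.Edge → ℝ} (hℓ : ∀ e, 0 < ℓ e) (t : T) (i : Fin 3) :
    2 * ℓ (Δ.edge t (i + 1)) * ℓ (Δ.edge t (i + 2)) * cornerCos ℓ (t, i) =
      ℓ (Δ.edge t (i + 1)) ^ 2 + ℓ (Δ.edge t (i + 2)) ^ 2 - ℓ (Δ.edge t i) ^ 2 := by
  have := hℓ (Δ.edge t (i + 1))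
  have := hℓ (Δ.edge t (i + 2))
  unfold cornerCos
  field_simp

theorem neg_one_lt_cornerCos_iff {ℓ : Δ.Edge → ℝ} (hℓ : ∀ e, 0 < ℓ e) (t : T) (i : Fin 3) :
    -1 < cornerCos ℓ (t, i) ↔
      ℓ (Δ.edge t i) < ℓ (Δ.edge t (i + 1)) + ℓ (Δ.edge t (i + 2)) := by
  have h := hℓ (Δ.edge t i)
  have h1 := hℓ (Δ.edge t (i + 1))
  have h2 := hℓ (Δ.edge t (i + 2))
  rw [← pow_lt_pow_iff_left₀ h.le (by positivity) two_ne_zero, cornerCos,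
    lt_div_iff₀ (by positivity)]
  constructor <;> intro <;> linarith

theorem TriangleInequalities.pos {ℓ : Δ.Edge → ℝ} (h : TriangleInequalities ℓ) (e : Δ.Edge) :
    0 < ℓ e := by
  obtain ⟨t, i⟩ := e
  have h1 := h t (i + 1)
  have h2 := h t (i + 2)
  simp only [fin_three_add_add] at h1 h2
  change 0 < ℓ (Δ.edge t i)
  linarith

theorem TriangleInequalities.neg_one_lt_cornerCos {ℓ : Δ.Edge → ℝ} (h : TriangleInequalities ℓ)
    (t : T) (i : Fin 3) : -1 < cornerCos ℓ (t, i) :=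
  (neg_one_lt_cornerCos_iff h.pos t i).2 (h t i)

theorem TriangleInequalities.cornerCos_lt_one {ℓ : Δ.Edge → ℝ} (h : TriangleInequalities ℓ)
    (t : T) (i : Fin 3) : cornerCos ℓ (t, i) < 1 := by
  have := h.pos (Δ.edge t (i + 1))
  have := h.pos (Δ.edge t (i + 2))
  have h12 := h t (i + 1)
  have h21 := h t (i + 2)
  simp only [fin_three_add_add] at h12 h21
  rw [cornerCos, div_lt_one (by positivity)]
  have := mul_pos (sub_pos.2 h12) (sub_pos.2 h21)
  linarith

theorem TriangleInequalities.cornerCos_sq_lt_one {ℓ : Δ.Edge → ℝ} (h : TriangleInequalities ℓ)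
    (t : T) (i : Fin 3) : cornerCos ℓ (t, i) ^ 2 < 1 :=
  (sq_lt_one_iff_abs_lt_one _).2
    (abs_lt.2 ⟨h.neg_one_lt_cornerCos t i, h.cornerCos_lt_one t i⟩)

end Triangulation

/-! ### Reduced paths -/

/-- `ReducedPath R x₀ x o` says that the tile `x` is reached from `x₀` by a path of tiles that never
turns back, entering `x` through the side `o` (`none` if the path is constant). Here `R x i y j`
says that the side `i` of `x` is attached to the side `j` of `y`. -/
inductive ReducedPath {X ι : Type*} (R : X → ι → X → ι → Prop) (x₀ : X) : X → Option ι → Prop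
  | base : ReducedPath R x₀ x₀ none
  | step {x o i y j} : ReducedPath R x₀ x o → o ≠ some i → R x i y j → ReducedPath R x₀ y (some j)

theorem ReducedPath.exists_of_reflTransGen {X ι : Type*} {R : X → ι → X → ι → Prop}
    {E : X → X → Prop} (hE : Equivalence E)
    (hlift : ∀ {x x' i y' j}, E x x' → R x' i y' j → ∃ y, E y y' ∧ R x i y j)
    (hback : ∀ {x i y j z k}, R x i y j → R y j z k → E x z) {x₀ y : X}
    (h : Relation.ReflTransGen (fun a b => ∃ i j, R a i b j) x₀ y) :
    ∃ y' o, E y' y ∧ ReducedPath R x₀ y' o := by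
  induction h with
  | refl => exact ⟨x₀, none, hE.refl _, .base⟩
  | tail _ hbc ih =>
    obtain ⟨x, o, hx, hr⟩ := ih
    obtain ⟨i, j, hij⟩ := hbc
    obtain ⟨y, hy, hxy⟩ := hlift hx hij
    by_cases ho : o = some i
    · subst ho
      cases hr with
      | step hp _ hpx => exact ⟨_, _, hE.trans (hback hpx hxy) hy, hp⟩
    · exact ⟨y, some j, hy, .step hr ho hxy⟩

theorem equivalence_eq_or_eq_neg (G : Type*) [InvolutiveNeg G] :
    Equivalence fun x y : G => y = x ∨ y = -x where
  refl _ := .inl rfl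
  symm := by rintro x _ (rfl | rfl) <;> simp
  trans := by rintro x _ _ (rfl | rfl) (rfl | rfl) <;> simp

/-! ### Ideal triangles and their circumscribed forms -/

namespace Triangulation

variable {T : Type*} {Δ : Triangulation T} {lam : Δ.Edge → ℝ}

namespace IdealTriangle

attribute [ext] IdealTriangle

theorem det_vec_add_two (σ : IdealTriangle lam) (i : Fin 3) :
    Hyp.det (σ.vec (i + 2)) (σ.vec i) = ell lam (Δ.edge σ.tri (i + 1)) := by
  simpa only [fin_three_add_add] using σ.det_eq (i + 1)

theorem det_vec_add_one (σ : IdealTriangle lam) (i : Fin 3) :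
    Hyp.det (σ.vec i) (σ.vec (i + 1)) = ell lam (Δ.edge σ.tri (i + 2)) := by
  simpa only [fin_three_add_add] using σ.det_eq (i + 2)

theorem vec_ne_zero (σ : IdealTriangle lam) (k : Fin 3) : σ.vec k ≠ 0 := fun h =>
  (ell_pos lam _).ne' (by rw [← σ.det_vec_add_one k, h]; simp [Hyp.det])

theorem ell_mul_det_add (σ : IdealTriangle lam) (i : Fin 3) (w : ℝ × ℝ) :
    ell lam (Δ.edge σ.tri i) * Hyp.det (σ.vec i) w +
      ell lam (Δ.edge σ.tri (i + 1)) * Hyp.det (σ.vec (i + 1)) w +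
        ell lam (Δ.edge σ.tri (i + 2)) * Hyp.det (σ.vec (i + 2)) w = 0 := by
  rw [← σ.det_eq, ← σ.det_vec_add_two, ← σ.det_vec_add_one]
  unfold Hyp.det
  ring

/-- The product of the determinants of the two vectors on the side `i` with `w`. It is negative if
`w` is centered on the same side of this geodesic as `σ`, and positive if it is centered on the
other side. -/
def sideProd (σ : IdealTriangle lam) (i : Fin 3) (w : ℝ × ℝ) : ℝ :=
  Hyp.det (σ.vec (i + 1)) w * Hyp.det (σ.vec (i + 2)) w

theorem sideProd_vec_self_neg (σ : IdealTriangle lam) (i : Fin 3) :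
    σ.sideProd i (σ.vec i) < 0 := by
  rw [sideProd, Hyp.det_swap, det_vec_add_two, det_vec_add_one, neg_mul, neg_neg_iff_pos]
  exact mul_pos (ell_pos lam _) (ell_pos lam _)

theorem sideProd_vec_nonpos (σ : IdealTriangle lam) (i k : Fin 3) :
    σ.sideProd i (σ.vec k) ≤ 0 := by
  revert k
  rw [forall_fin_three i]
  exact ⟨(σ.sideProd_vec_self_neg i).le, by simp [sideProd, Hyp.det_self]⟩

theorem sideProd_nonpos_of_nonneg (σ : IdealTriangle lam) {i j : Fin 3} (hij : j ≠ i)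
    {w : ℝ × ℝ} (h : 0 ≤ σ.sideProd i w) : σ.sideProd j w ≤ 0 := by
  revert j
  have hsum := σ.ell_mul_det_add i w
  have h0 := ell_pos lam (Δ.edge σ.tri i)
  have h1 := ell_pos lam (Δ.edge σ.tri (i + 1))
  have h2 := ell_pos lam (Δ.edge σ.tri (i + 2))
  simp only [forall_fin_three i, sideProd, fin_three_add_add, ne_eq, not_true_eq_false,
    IsEmpty.forall_iff, true_and] at h ⊢
  set x := Hyp.det (σ.vec i) w
  set y := Hyp.det (σ.vec (i + 1)) w
  set z := Hyp.det (σ.vec (i + 2)) w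
  refine ⟨fun _ => nonpos_of_mul_nonpos_right (a := ell lam (Δ.edge σ.tri i)) ?_ h0,
    fun _ => nonpos_of_mul_nonpos_right (a := ell lam (Δ.edge σ.tri i)) ?_ h0⟩
  · linear_combination z * hsum + mul_nonneg h1.le h + mul_nonneg h2.le (sq_nonneg z)
  · linear_combination y * hsum + mul_nonneg h2.le h + mul_nonneg h1.le (sq_nonneg y)

/-- The circumscribed form of `σ`: the quadratic form taking the value `1` at the three vectors
of `σ`, given by Lagrange interpolation. -/
noncomputable def circumForm (σ : IdealTriangle lam) (w : ℝ × ℝ) : ℝ :=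
  -(∑ i, ell lam (Δ.edge σ.tri i) * σ.sideProd i w) / ∏ i, ell lam (Δ.edge σ.tri i)

theorem ell_sq_mul_circumForm (σ : IdealTriangle lam) (i : Fin 3) (w : ℝ × ℝ) :
    ell lam (Δ.edge σ.tri i) ^ 2 * σ.circumForm w =
      Hyp.det (σ.vec (i + 1)) w ^ 2 + Hyp.det (σ.vec (i + 2)) w ^ 2 +
        2 * cornerCos (ell lam) (σ.tri, i) * σ.sideProd i w := by
  have hsum := σ.ell_mul_det_add i w
  have := ell_pos lam (Δ.edge σ.tri i)
  have := ell_pos lam (Δ.edge σ.tri (i + 1))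
  have := ell_pos lam (Δ.edge σ.tri (i + 2))
  simp only [circumForm, cornerCos, sum_fin_three _ i, prod_fin_three _ i, sideProd,
    fin_three_add_add]
  set x := Hyp.det (σ.vec i) w
  set y := Hyp.det (σ.vec (i + 1)) w
  set z := Hyp.det (σ.vec (i + 2)) w
  field_simp
  linear_combination -(ell lam (Δ.edge σ.tri (i + 1)) * z + ell lam (Δ.edge σ.tri (i + 2)) * y) *
    hsum

theorem circumForm_vec (σ : IdealTriangle lam) (k : Fin 3) : σ.circumForm (σ.vec k) = 1 := by
  have h := σ.ell_sq_mul_circumForm (k + 1) (σ.vec k)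
  simp only [fin_three_add_add, sideProd, Hyp.det_self, det_vec_add_two] at h
  exact mul_left_cancel₀ (pow_pos (ell_pos lam (Δ.edge σ.tri (k + 1))) 2).ne' (by linarith)

theorem circumForm_neg (σ : IdealTriangle lam) (w : ℝ × ℝ) :
    σ.circumForm (-w) = σ.circumForm w := by
  simp only [circumForm, sideProd, Hyp.det_neg_right, neg_mul_neg]

theorem horoForm_eq_mul_circumForm (σ : IdealTriangle lam) {c : UpperHalfPlane} {ρ : ℝ}
    (h : ∀ k, Hyp.horoForm c (σ.vec k) = ρ) (w : ℝ × ℝ) :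
    Hyp.horoForm c w = ρ * σ.circumForm w := by
  have hlagrange := Hyp.det_mul_horoForm c (σ.vec 0) (σ.vec (0 + 1)) (σ.vec (0 + 2)) w
  rw [σ.det_eq, σ.det_vec_add_two, σ.det_vec_add_one, h, h, h] at hlagrange
  have h0 := ell_pos lam (Δ.edge σ.tri 0)
  have h1 := ell_pos lam (Δ.edge σ.tri (0 + 1))
  have h2 := ell_pos lam (Δ.edge σ.tri (0 + 2))
  simp only [circumForm, sum_fin_three _ 0, prod_fin_three _ 0, sideProd, fin_three_add_add]
  field_simp
  linear_combination hlagrange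

theorem ell_lt_of_circumForm_pos (σ : IdealTriangle lam) (h : ∀ w ≠ 0, 0 < σ.circumForm w)
    (i : Fin 3) : ell lam (Δ.edge σ.tri i) <
      ell lam (Δ.edge σ.tri (i + 1)) + ell lam (Δ.edge σ.tri (i + 2)) := by
  have h0 := ell_pos lam (Δ.edge σ.tri i)
  set w := σ.vec (i + 1) - σ.vec (i + 2) with hw
  have hdet1 : Hyp.det (σ.vec (i + 1)) w = -ell lam (Δ.edge σ.tri i) := by
    rw [← σ.det_eq, hw]; simp only [Hyp.det, Prod.fst_sub, Prod.snd_sub]; ring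
  have hdet2 : Hyp.det (σ.vec (i + 2)) w = -ell lam (Δ.edge σ.tri i) := by
    rw [← σ.det_eq, hw]; simp only [Hyp.det, Prod.fst_sub, Prod.snd_sub]; ring
  have hw0 : w ≠ 0 := fun hw0 => h0.ne' (by rw [← neg_neg (ell _ _), ← hdet1, hw0]; simp [Hyp.det])
  have hform := σ.ell_sq_mul_circumForm i w
  rw [sideProd, hdet1, hdet2] at hform
  have hpos : 0 < ell lam (Δ.edge σ.tri i) ^ 2 * (2 * (1 + cornerCos (ell lam) (σ.tri, i))) := by
    have := mul_pos (pow_pos h0 2) (h w hw0)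
    linarith
  refine (neg_one_lt_cornerCos_iff (ell_pos lam) _ _).1 ?_
  linarith [pos_of_mul_pos_right hpos (sq_nonneg _)]

/-- The circumscribed form is a positive multiple of `a² + b²` with the linear forms
`a = det (vec 1 + k vec 2)` and `b = √(1 - k²) det (vec 2)`, where `k` is the cosine of the angle
at the corner `0`. -/
theorem exists_horoForm_eq (σ : IdealTriangle lam) (h : TriangleInequalities (ell lam)) :
    ∃ (c : UpperHalfPlane) (ρ : ℝ), 0 < ρ ∧ ∀ w, Hyp.horoForm c w = ρ * σ.circumForm w := by
  have hcos := h.cornerCos_sq_lt_one σ.tri 0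
  have hform := σ.ell_sq_mul_circumForm 0
  have hdet := σ.det_eq 0
  have hell := ell_pos lam (Δ.edge σ.tri 0)
  set k := cornerCos (ell lam) (σ.tri, 0)
  set u := σ.vec (0 + 1)
  set v := σ.vec (0 + 2)
  obtain ⟨S, hS, hS2⟩ : ∃ S > 0, S ^ 2 = 1 - k ^ 2 :=
    ⟨√(1 - k ^ 2), Real.sqrt_pos.2 (by linarith), Real.sq_sqrt (by linarith)⟩
  have hab : Hyp.det (u + k • v) (S • v) = S * ell lam (Δ.edge σ.tri 0) := by
    rw [← hdet]; simp only [Hyp.det, Prod.fst_add, Prod.snd_add, Prod.smul_fst, Prod.smul_snd,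
      smul_eq_mul]; ring
  obtain ⟨c, hc⟩ := Hyp.exists_det_mul_horoForm_eq (hab ▸ mul_pos hS hell)
  refine ⟨c, ell lam (Δ.edge σ.tri 0) / S, div_pos hell hS, fun w => ?_⟩
  have hsq : Hyp.det (u + k • v) w ^ 2 + Hyp.det (S • v) w ^ 2 =
      ell lam (Δ.edge σ.tri 0) ^ 2 * σ.circumForm w := by
    have hu : Hyp.det (u + k • v) w = Hyp.det u w + k * Hyp.det v w := by
      simp only [Hyp.det, Prod.fst_add, Prod.snd_add, Prod.smul_fst, Prod.smul_snd, smul_eq_mul]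
      ring
    have hv : Hyp.det (S • v) w = S * Hyp.det v w := by
      simp only [Hyp.det, Prod.smul_fst, Prod.smul_snd, smul_eq_mul]; ring
    rw [hform, hu, hv, sideProd]
    linear_combination Hyp.det v w ^ 2 * hS2
  have := hc w
  rw [hab, hsq] at this
  field_simp
  exact mul_left_cancel₀ hell.ne' (by linarith)

theorem ell_le_of_horoForm_eq (σ : IdealTriangle lam) {c : UpperHalfPlane} {ρ : ℝ} (hρ : 0 ≤ ρ)
    (h : ∀ k, Hyp.horoForm c (σ.vec k) = ρ) (i : Fin 3) : ell lam (Δ.edge σ.tri i) ≤ ρ := by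
  have hle := Hyp.det_sq_le_horoForm_mul c (σ.vec (i + 1)) (σ.vec (i + 2))
  rw [σ.det_eq, h, h, ← sq] at hle
  exact (abs_le_of_sq_le_sq' hle hρ).2

end IdealTriangle

/-! ### Lifts of the triangulation to the hyperbolic plane -/

namespace IdealTriangle

/-- The side `i` of `σ` is attached to the side `j` of `τ`. -/
def AdjAt (σ : IdealTriangle lam) (i : Fin 3) (τ : IdealTriangle lam) (j : Fin 3) : Prop :=
  Δ.glue (σ.tri, i) = (τ.tri, j) ∧
    τ.vec (j + 1) = σ.vec (i + 2) ∧ τ.vec (j + 2) = -σ.vec (i + 1)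

theorem AdjAt.adj {σ τ : IdealTriangle lam} {i j : Fin 3} (h : σ.AdjAt i τ j) : σ.Adj i τ :=
  ⟨j, h⟩

theorem ext_side {σ τ : IdealTriangle lam} (htri : σ.tri = τ.tri) (i : Fin 3)
    (h1 : σ.vec (i + 1) = τ.vec (i + 1)) (h2 : σ.vec (i + 2) = τ.vec (i + 2)) : σ = τ := by
  have hdet : Hyp.det (σ.vec (i + 1)) (σ.vec (i + 2)) ≠ 0 :=
    (σ.det_eq i).symm ▸ (ell_pos lam _).ne'
  refine IdealTriangle.ext htri (funext ((forall_fin_three i).2 ⟨?_, h1, h2⟩))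
  refine Hyp.eq_of_det_eq hdet ?_ ?_
  · rw [Hyp.det_swap, det_vec_add_one, h1, Hyp.det_swap, det_vec_add_one, htri]
  · rw [det_vec_add_two, h2, det_vec_add_two, htri]

theorem exists_tri_vec_eq (t : T) (j : Fin 3) {p q : ℝ × ℝ}
    (h : Hyp.det p q = ell lam (Δ.edge t j)) :
    ∃ τ : IdealTriangle lam, τ.tri = t ∧ τ.vec (j + 1) = p ∧ τ.vec (j + 2) = q := by
  have h0 := ell_pos lam (Δ.edge t j)
  obtain ⟨f, hf, hf1, hf2⟩ := exists_fin_three j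
    (-(ell lam (Δ.edge t (j + 1)) / ell lam (Δ.edge t j)) • p -
      (ell lam (Δ.edge t (j + 2)) / ell lam (Δ.edge t j)) • q) p q
  refine ⟨⟨t, f, (forall_fin_three j).2 ?_⟩, rfl, hf1, hf2⟩
  simp only [fin_three_add_add, hf, hf1, hf2, h, true_and]
  simp only [Hyp.det, Prod.fst_sub, Prod.snd_sub, Prod.smul_fst, Prod.smul_snd,
    smul_eq_mul] at h ⊢
  constructor
  · field_simp
    linear_combination ell lam (Δ.edge t (j + 1)) * h
  · field_simp
    linear_combination ell lam (Δ.edge t (j + 2)) * h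

theorem exists_adjAt (σ : IdealTriangle lam) (i : Fin 3) : ∃ τ, ∃ j, σ.AdjAt i τ j := by
  obtain ⟨τ, htri, h1, h2⟩ := exists_tri_vec_eq (lam := lam) (Δ.glue (σ.tri, i)).1
    (Δ.glue (σ.tri, i)).2 (p := σ.vec (i + 2)) (q := -σ.vec (i + 1)) (by
      rw [edge_eq_of_glue rfl, Hyp.det_neg_right, ← Hyp.det_swap, σ.det_eq])
  exact ⟨τ, _, by rw [htri], h1, h2⟩

theorem exists_tri_eq (lam : Δ.Edge → ℝ) (t : T) : ∃ τ : IdealTriangle lam, τ.tri = t := by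
  obtain ⟨τ, htri, -⟩ := exists_tri_vec_eq (lam := lam) t 0 (p := (1, 0))
    (q := (0, ell lam (Δ.edge t 0))) (by simp [Hyp.det])
  exact ⟨τ, htri⟩

instance : Neg (IdealTriangle lam) where
  neg σ := ⟨σ.tri, -σ.vec, fun i => by
    simp only [Pi.neg_apply, Hyp.det_neg_left, Hyp.det_neg_right, neg_neg, σ.det_eq]⟩

theorem vec_neg (σ : IdealTriangle lam) (k : Fin 3) : (-σ).vec k = -σ.vec k := rfl

instance : InvolutiveNeg (IdealTriangle lam) where
  neg_neg _ := IdealTriangle.ext rfl (neg_neg _)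

theorem AdjAt.neg {σ τ : IdealTriangle lam} {i j : Fin 3} (h : σ.AdjAt i τ j) :
    (-σ).AdjAt i (-τ) j :=
  ⟨h.1, congrArg Neg.neg h.2.1, congrArg Neg.neg h.2.2⟩

theorem AdjAt.symm_neg {σ τ : IdealTriangle lam} {i j : Fin 3} (h : σ.AdjAt i τ j) :
    τ.AdjAt j (-σ) i :=
  ⟨by rw [← h.1, Δ.glue_glue]; rfl, h.2.2.symm, congrArg Neg.neg h.2.1.symm⟩

theorem AdjAt.eq_neg_of_adjAt {σ τ ρ : IdealTriangle lam} {i j k : Fin 3} (h : σ.AdjAt i τ j)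
    (h' : τ.AdjAt j ρ k) : ρ = -σ := by
  obtain ⟨htri, rfl⟩ := Prod.ext_iff.1 (h'.1.symm.trans h.symm_neg.1)
  exact ext_side htri k (h'.2.1.trans h.symm_neg.2.1.symm) (h'.2.2.trans h.symm_neg.2.2.symm)

theorem AdjAt.sideProd_eq {σ τ : IdealTriangle lam} {i j : Fin 3} (h : σ.AdjAt i τ j)
    (w : ℝ × ℝ) : τ.sideProd j w = -σ.sideProd i w := by
  rw [sideProd, sideProd, h.2.1, h.2.2, Hyp.det_neg_left, mul_neg, mul_comm]

theorem AdjAt.ell_sq_mul_circumForm_sub {σ τ : IdealTriangle lam} {i j : Fin 3}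
    (h : σ.AdjAt i τ j) (w : ℝ × ℝ) :
    ell lam (Δ.edge σ.tri i) ^ 2 * (σ.circumForm w - τ.circumForm w) =
      2 * (cornerCos (ell lam) (σ.tri, i) + cornerCos (ell lam) (Δ.glue (σ.tri, i))) *
        σ.sideProd i w := by
  have hτ := τ.ell_sq_mul_circumForm j w
  rw [edge_eq_of_glue h.1, h.sideProd_eq, h.2.1, h.2.2, Hyp.det_neg_left] at hτ
  rw [mul_sub, σ.ell_sq_mul_circumForm, hτ, h.1]
  ring

/-- The center of `w` does not lie behind the side `o`, as seen by somebody who has entered `τ`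
through this side. -/
def LiesAhead (τ : IdealTriangle lam) (o : Option (Fin 3)) (w : ℝ × ℝ) : Prop :=
  ∀ j ∈ o, τ.sideProd j w ≤ 0

theorem liesAhead_vec (τ : IdealTriangle lam) (o : Option (Fin 3)) (k : Fin 3) :
    τ.LiesAhead o (τ.vec k) :=
  fun j _ => τ.sideProd_vec_nonpos j k

theorem AdjAt.sideProd_nonneg {σ τ : IdealTriangle lam} {i j : Fin 3} {w : ℝ × ℝ}
    (h : σ.AdjAt i τ j) (hw : τ.LiesAhead (some j) w) : 0 ≤ σ.sideProd i w := by
  have := hw j rfl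
  rw [h.sideProd_eq] at this
  linarith

theorem AdjAt.liesAhead {σ τ : IdealTriangle lam} {o : Option (Fin 3)} {i j : Fin 3} {w : ℝ × ℝ}
    (h : σ.AdjAt i τ j) (ho : o ≠ some i) (hw : τ.LiesAhead (some j) w) : σ.LiesAhead o w :=
  fun _ hk => σ.sideProd_nonpos_of_nonneg (fun hki => ho (hk.trans (congrArg some hki)))
    (h.sideProd_nonneg hw)

end IdealTriangle

open IdealTriangle

theorem exists_isLift_tri_eq (σ₀ : IdealTriangle lam) (t : T) : ∃ σ, IsLift σ₀ σ ∧ σ.tri = t := by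
  induction Δ.connected σ₀.tri t with
  | refl => exact ⟨σ₀, .refl, rfl⟩
  | tail _ hbc ih =>
    obtain ⟨σ, hσ, rfl⟩ := ih
    obtain ⟨i, rfl⟩ := hbc
    obtain ⟨τ, j, hτ⟩ := σ.exists_adjAt i
    exact ⟨τ, hσ.tail ⟨i, hτ.adj⟩, by rw [hτ.1]⟩

/-- Crossing a side and returning reverses the sign. -/
theorem isLift_neg (σ : IdealTriangle lam) : IsLift σ (-σ) := by
  obtain ⟨τ, j, h⟩ := σ.exists_adjAt 0
  exact .tail (.single ⟨0, h.adj⟩) ⟨j, h.symm_neg.adj⟩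

theorem IsLift.symm {σ τ : IdealTriangle lam} (h : IsLift σ τ) : IsLift τ σ := by
  induction h with
  | refl => exact .refl
  | @tail x y _ hxy ih =>
    obtain ⟨i, j, hxy⟩ := hxy
    have hneg : IsLift (-x) x := by simpa only [neg_neg] using isLift_neg (-x)
    exact .head ⟨j, AdjAt.adj (AdjAt.symm_neg hxy)⟩ (hneg.trans ih)

theorem IsLift.exists_reducedPath {σ τ : IdealTriangle lam} (h : IsLift σ τ) :
    ∃ τ' o, (τ = τ' ∨ τ = -τ') ∧ ReducedPath AdjAt σ τ' o := by
  refine ReducedPath.exists_of_reflTransGen (equivalence_eq_or_eq_neg (IdealTriangle lam)) ?_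
    (fun hxy hyz => .inr (hxy.eq_neg_of_adjAt hyz)) h
  rintro x x' i y' j (rfl | rfl) hxy
  · exact ⟨y', .inl rfl, hxy⟩
  · exact ⟨-y', .inr (neg_neg y').symm, by simpa only [neg_neg] using hxy.neg⟩

namespace LocallyDelaunay

variable {σ τ : IdealTriangle lam}

theorem circumForm_le_of_adjAt (hD : LocallyDelaunay (ell lam)) {i j : Fin 3}
    (h : σ.AdjAt i τ j) {w : ℝ × ℝ} (hw : 0 ≤ σ.sideProd i w) :
    τ.circumForm w ≤ σ.circumForm w := by
  have hcos := mul_nonneg (hD (σ.tri, i)) hw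
  have hsub := h.ell_sq_mul_circumForm_sub w
  exact sub_nonneg.1 (nonneg_of_mul_nonneg_right (a := ell lam (Δ.edge σ.tri i) ^ 2)
    (by linarith) (pow_pos (ell_pos lam _) 2))

theorem circumForm_lt_of_adjAt {i j : Fin 3} (h : σ.AdjAt i τ j)
    (hi : Δ.edge σ.tri i ∈ essentialEdges (ell lam)) {w : ℝ × ℝ} (hw : 0 < σ.sideProd i w) :
    τ.circumForm w < σ.circumForm w := by
  have hcos := mul_pos (edge_mem_essentialEdges.1 hi) hw
  have hsub := h.ell_sq_mul_circumForm_sub w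
  exact sub_pos.1 (pos_of_mul_pos_right (a := ell lam (Δ.edge σ.tri i) ^ 2)
    (by linarith) (sq_nonneg _))

theorem circumForm_eq_of_sameFace (hD : LocallyDelaunay (ell lam))
    (h : SameFace (essentialEdges (ell lam)) σ τ) (w : ℝ × ℝ) :
    τ.circumForm w = σ.circumForm w := by
  induction h with
  | refl => rfl
  | @tail x y _ hxy ih =>
    obtain ⟨i, hi, j, hxy⟩ := hxy
    have hsub := AdjAt.ell_sq_mul_circumForm_sub hxy w
    rw [le_antisymm (not_lt.1 (mt edge_mem_essentialEdges.2 hi)) (hD (x.tri, i)), mul_zero,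
      zero_mul, mul_eq_zero, or_iff_right (pow_pos (ell_pos lam _) 2).ne', sub_eq_zero] at hsub
    exact hsub ▸ ih

theorem circumForm_le_of_reducedPath (hD : LocallyDelaunay (ell lam)) {o : Option (Fin 3)}
    (h : ReducedPath AdjAt σ τ o) {w : ℝ × ℝ} (hw : τ.LiesAhead o w) :
    τ.circumForm w ≤ σ.circumForm w := by
  induction h with
  | base => rfl
  | step _ ho hxy ih =>
    exact (hD.circumForm_le_of_adjAt hxy (hxy.sideProd_nonneg hw)).trans (ih (hxy.liesAhead ho hw))

theorem sameFace_or_circumForm_lt_of_reducedPath (hD : LocallyDelaunay (ell lam))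
    {o : Option (Fin 3)} (h : ReducedPath AdjAt σ τ o) {w : ℝ × ℝ} (hw : τ.LiesAhead o w)
    (hvec : ∀ ρ k, SameFace (essentialEdges (ell lam)) σ ρ → Hyp.det (ρ.vec k) w ≠ 0) :
    SameFace (essentialEdges (ell lam)) σ τ ∨ τ.circumForm w < σ.circumForm w := by
  induction h with
  | base => exact .inl .refl
  | @step x o i y j _ ho hxy ih =>
    have hprod := hxy.sideProd_nonneg hw
    rcases ih (hxy.liesAhead ho hw) with hface | hlt
    · by_cases hi : Δ.edge x.tri i ∈ essentialEdges (ell lam)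
      · rw [← hD.circumForm_eq_of_sameFace hface]
        have hne := mul_ne_zero (hvec x (i + 1) hface) (hvec x (i + 2) hface)
        exact .inr (circumForm_lt_of_adjAt hxy hi (hprod.lt_of_ne' hne))
      · exact .inl (hface.tail ⟨i, hi, hxy.adj⟩)
    · exact .inr ((hD.circumForm_le_of_adjAt hxy hprod).trans_lt hlt)

theorem one_le_circumForm (hD : LocallyDelaunay (ell lam)) (h : IsLift σ τ) (k : Fin 3) :
    1 ≤ σ.circumForm (τ.vec k) := by
  obtain ⟨τ', o, hτ, hpath⟩ := h.exists_reducedPath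
  have hle := hD.circumForm_le_of_reducedPath hpath (τ'.liesAhead_vec o k)
  rw [circumForm_vec] at hle
  rcases hτ with rfl | rfl
  · exact hle
  · rwa [vec_neg, circumForm_neg]

end LocallyDelaunay

/-! ### The ideal Delaunay condition is local -/

namespace IdealTriangle

theorem eq_or_eq_neg_of_det_eq_zero (σ : IdealTriangle lam) {k : Fin 3} {w : ℝ × ℝ}
    (hdet : Hyp.det (σ.vec k) w = 0) (hw : σ.circumForm w = 1) :
    w = σ.vec k ∨ w = -σ.vec k := by
  have hbasis : Hyp.det (σ.vec (k + 2)) (σ.vec k) ≠ 0 :=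
    σ.det_vec_add_two k ▸ (ell_pos lam _).ne'
  have hform := σ.ell_sq_mul_circumForm (k + 1) w
  simp only [fin_three_add_add, sideProd, hdet, hw, mul_one, mul_zero, add_zero,
    zero_pow two_ne_zero, ← det_vec_add_two] at hform
  rcases sq_eq_sq_iff_eq_or_eq_neg.1 hform.symm with h | h
  · exact .inl (Hyp.eq_of_det_eq hbasis h (hdet.trans (Hyp.det_self _).symm))
  · exact .inr (Hyp.eq_of_det_eq hbasis (h.trans (Hyp.det_neg_right _ _).symm)
      (by rw [hdet, Hyp.det_neg_right, Hyp.det_self, neg_zero]))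

/-- The reason is Ptolemy's relation between the sides and diagonals of the quadrilateral spanned by
`σ` and `w`. -/
theorem exists_ell_le_abs_det (σ : IdealTriangle lam) (hT : TriangleInequalities (ell lam))
    {i : Fin 3} {w : ℝ × ℝ} (hprod : 0 ≤ σ.sideProd i w) (hw : 1 ≤ σ.circumForm w) :
    ∃ e, ell lam e ≤ |Hyp.det (σ.vec i) w| := by
  have h0 := ell_pos lam (Δ.edge σ.tri i)
  have h1 := ell_pos lam (Δ.edge σ.tri (i + 1))
  have h2 := ell_pos lam (Δ.edge σ.tri (i + 2))
  have hcos := hT.cornerCos_lt_one σ.tri i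
  have hform := σ.ell_sq_mul_circumForm i w
  have hsum := σ.ell_mul_det_add i w
  rw [sideProd] at hprod hform
  set x := Hyp.det (σ.vec i) w
  set y := Hyp.det (σ.vec (i + 1)) w
  set z := Hyp.det (σ.vec (i + 2)) w
  have hside : ell lam (Δ.edge σ.tri i) ≤ |y| + |z| := by
    rw [← (abs_add_eq_add_abs_iff _ _).2 (mul_nonneg_iff.1 hprod)]
    refine (le_abs_self _).trans (sq_le_sq.1 ?_)
    linarith [mul_nonneg hprod (sub_nonneg.2 hcos.le),
      mul_nonneg (sq_nonneg (ell lam (Δ.edge σ.tri i))) (sub_nonneg.2 hw)]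
  have hptolemy : ell lam (Δ.edge σ.tri i) * |x| =
      ell lam (Δ.edge σ.tri (i + 1)) * |y| + ell lam (Δ.edge σ.tri (i + 2)) * |z| := by
    rw [← abs_of_pos h0, ← abs_of_pos h1, ← abs_of_pos h2, ← abs_mul, ← abs_mul, ← abs_mul,
      ← abs_neg]
    have hprod' := mul_nonneg (mul_nonneg h1.le h2.le) hprod
    rw [mul_mul_mul_comm] at hprod'
    rw [← (abs_add_eq_add_abs_iff _ _).2 (mul_nonneg_iff.1 hprod')]
    congr 1
    linear_combination -hsum
  obtain ⟨e, he1, he2⟩ : ∃ e, ell lam e ≤ ell lam (Δ.edge σ.tri (i + 1)) ∧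
      ell lam e ≤ ell lam (Δ.edge σ.tri (i + 2)) :=
    (le_total _ _).elim (fun h => ⟨_, le_rfl, h⟩) (fun h => ⟨_, h, le_rfl⟩)
  refine ⟨e, le_of_mul_le_mul_left ?_ h0⟩
  calc ell lam (Δ.edge σ.tri i) * ell lam e ≤ (|y| + |z|) * ell lam e := by
        gcongr; exact (ell_pos lam e).le
    _ = ell lam e * |y| + ell lam e * |z| := by ring
    _ ≤ ell lam (Δ.edge σ.tri (i + 1)) * |y| + ell lam (Δ.edge σ.tri (i + 2)) * |z| := by gcongr
    _ = ell lam (Δ.edge σ.tri i) * |x| := hptolemy.symm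

end IdealTriangle

namespace LocallyDelaunay

variable {σ τ : IdealTriangle lam}

theorem exists_sameFace_of_circumForm_eq_one (hD : LocallyDelaunay (ell lam)) (h : IsLift σ τ)
    {k : Fin 3} (hk : σ.circumForm (τ.vec k) = 1) :
    ∃ ρ l, SameFace (essentialEdges (ell lam)) σ ρ ∧
      (τ.vec k = ρ.vec l ∨ τ.vec k = -ρ.vec l) := by
  obtain ⟨τ', o, hτ, hpath⟩ := h.exists_reducedPath
  have hk' : σ.circumForm (τ'.vec k) = 1 := by
    rcases hτ with rfl | rfl
    · exact hk
    · rwa [vec_neg, circumForm_neg] at hk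
  have key : ∃ ρ l, SameFace (essentialEdges (ell lam)) σ ρ ∧
      (τ'.vec k = ρ.vec l ∨ τ'.vec k = -ρ.vec l) := by
    by_contra! hne
    have hvec (ρ : IdealTriangle lam) (l : Fin 3) (hρ : SameFace (essentialEdges (ell lam)) σ ρ) :
        Hyp.det (ρ.vec l) (τ'.vec k) ≠ 0 := fun hdet =>
      (ρ.eq_or_eq_neg_of_det_eq_zero hdet (hD.circumForm_eq_of_sameFace hρ _ ▸ hk')).elim
        (hne ρ l hρ).1 (hne ρ l hρ).2
    rcases hD.sameFace_or_circumForm_lt_of_reducedPath hpath (τ'.liesAhead_vec o k) hvec with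
      hface | hlt
    · exact (hne τ' k hface).1 rfl
    · rw [circumForm_vec, hk'] at hlt
      exact hlt.false
  obtain ⟨ρ, l, hρ, hl⟩ := key
  refine ⟨ρ, l, hρ, ?_⟩
  rcases hτ with rfl | rfl
  · exact hl
  · rwa [vec_neg, neg_eq_iff_eq_neg, neg_inj, or_comm]

theorem exists_ell_le_abs_det_of_reducedPath (hD : LocallyDelaunay (ell lam))
    (hT : TriangleInequalities (ell lam)) {o : Option (Fin 3)} (h : ReducedPath AdjAt σ τ o)
    {w : ℝ × ℝ} (hw : τ.LiesAhead o w) (hone : 1 ≤ τ.circumForm w) (k : Fin 3) :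
    (∃ l, σ.vec k = τ.vec l ∨ σ.vec k = -τ.vec l) ∨
      ∃ e, ell lam e ≤ |Hyp.det (σ.vec k) w| := by
  induction h with
  | base => exact .inl ⟨k, .inl rfl⟩
  | @step x o i y j _ ho hxy ih =>
    have hprod := hxy.sideProd_nonneg hw
    have hone' := hone.trans (hD.circumForm_le_of_adjAt hxy hprod)
    rcases ih (hxy.liesAhead ho hw) hone' with ⟨l, hl⟩ | hle
    · revert l
      rw [forall_fin_three i]
      refine ⟨fun hl => .inr ?_, fun hl => .inl ⟨j + 2, ?_⟩, fun hl => .inl ⟨j + 1, ?_⟩⟩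
      · have hle := x.exists_ell_le_abs_det hT hprod hone'
        rcases hl with hl | hl <;> rw [hl]
        · exact hle
        · rwa [Hyp.det_neg_left, abs_neg]
      · rwa [hxy.2.2, neg_neg, or_comm]
      · rwa [hxy.2.1]
    · exact .inr hle

theorem eq_or_eq_neg_or_exists_ell_le_abs_det (hD : LocallyDelaunay (ell lam))
    (hT : TriangleInequalities (ell lam)) (h : IsLift σ τ) (k l : Fin 3) :
    (τ.vec l = σ.vec k ∨ τ.vec l = -σ.vec k) ∨
      ∃ e, ell lam e ≤ |Hyp.det (σ.vec k) (τ.vec l)| := by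
  obtain ⟨τ', o, hτ, hpath⟩ := h.exists_reducedPath
  have hτl : τ.vec l = τ'.vec l ∨ τ.vec l = -τ'.vec l := by
    rcases hτ with rfl | rfl <;> simp [vec_neg]
  have habs : |Hyp.det (σ.vec k) (τ.vec l)| = |Hyp.det (σ.vec k) (τ'.vec l)| := by
    rcases hτl with hl | hl <;> simp [hl, Hyp.det_neg_right]
  rw [habs]
  rcases hD.exists_ell_le_abs_det_of_reducedPath hT hpath (τ'.liesAhead_vec o l)
    (τ'.circumForm_vec l).ge k with ⟨m, hm⟩ | hle
  · revert m
    rw [forall_fin_three l]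
    refine ⟨fun hm => .inl ?_, fun hm => .inr ⟨Δ.edge τ'.tri (l + 2), Eq.le ?_⟩,
      fun hm => .inr ⟨Δ.edge τ'.tri (l + 1), Eq.le ?_⟩⟩
    · rcases hτl with hl | hl <;> rcases hm with hm | hm <;> simp [hl, hm]
    · rcases hm with hm | hm <;> simp [hm, Hyp.det_neg_right, Hyp.det_swap (τ'.vec l),
        det_vec_add_one, abs_of_pos (ell_pos lam _)]
    · rcases hm with hm | hm <;> simp [hm, Hyp.det_neg_left, det_vec_add_two,
        abs_of_pos (ell_pos lam _)]
  · exact .inr hle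

theorem disjointCuspNeighborhoods (hD : LocallyDelaunay (ell lam))
    (hT : TriangleInequalities (ell lam)) {s : ℝ} (hs : ∀ e, Real.exp (-s) ≤ ell lam e)
    (σ₀ : IdealTriangle lam) : DisjointCuspNeighborhoods σ₀ s := by
  intro σ k τ l hσ hτ hne
  rcases hD.eq_or_eq_neg_or_exists_ell_le_abs_det hT (hσ.symm.trans hτ) k l with (h | h) | ⟨e, he⟩
  · exact absurd (congrArg (Hyp.horocycle · s) h.symm) hne
  · exact absurd (by rw [h, Hyp.horocycle_neg]) hne
  · exact Hyp.disjoint_horodisk (σ.vec_ne_zero k) (τ.vec_ne_zero l) ((hs e).trans he)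

theorem globalDelaunay (hD : LocallyDelaunay (ell lam)) (hT : TriangleInequalities (ell lam))
    {s : ℝ} (hs : ∀ e, Real.exp (-s) < ell lam e) (σ₀ : IdealTriangle lam) :
    GlobalDelaunay σ₀ (essentialEdges (ell lam)) s := by
  intro σ hσ
  obtain ⟨c, ρ, hρ, hc⟩ := σ.exists_horoForm_eq hT
  have hr : 0 < Real.log ρ + s := by
    have hle := σ.ell_le_of_horoForm_eq hρ.le (fun k => by rw [hc, circumForm_vec, mul_one]) 0
    linarith [(Real.lt_log_iff_exp_lt hρ).2 ((hs _).trans_le hle)]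
  refine ⟨c, Real.log ρ + s, hr, fun τ k hτ => ?_, ?_⟩
  · refine Hyp.touchesExternally_of_signedDist_eq (τ.vec_ne_zero k) hr.le ?_
    rw [Hyp.signedDist_eq_log_horoForm, hc, ← hD.circumForm_eq_of_sameFace hτ, circumForm_vec,
      mul_one, add_sub_cancel_right]
  · rintro _ ⟨τ, k, hτ, rfl⟩ hnot
    have hστ := hσ.symm.trans hτ
    have hne : σ.circumForm (τ.vec k) ≠ 1 := fun h => hnot <| by
      obtain ⟨τ', l, hτ', hl | hl⟩ := hD.exists_sameFace_of_circumForm_eq_one hστ h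
      · exact ⟨τ', l, hτ', by rw [hl]⟩
      · exact ⟨τ', l, hτ', by rw [hl, Hyp.horocycle_neg]⟩
    refine Hyp.disjoint_sphere_horocycle (τ.vec_ne_zero k) ?_
    rw [Hyp.signedDist_eq_log_horoForm, hc, add_sub_cancel_right]
    exact Real.log_lt_log hρ
      (lt_mul_of_one_lt_right hρ ((hD.one_le_circumForm hστ k).lt_of_ne' hne))

theorem isIdealDelaunay [Nonempty T] (hD : LocallyDelaunay (ell lam))
    (hT : TriangleInequalities (ell lam)) (hlam : BddBelow (Set.range lam)) :
    IsIdealDelaunay lam := by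
  obtain ⟨m, hm⟩ := hlam
  have hs (e) : Real.exp (-(|m| / 2 + 1)) < ell lam e := by
    have := hm (Set.mem_range_self e)
    exact Real.exp_lt_exp.2 (by linarith [neg_abs_le m])
  obtain ⟨σ₀, -⟩ := exists_tri_eq lam (Classical.arbitrary T)
  exact ⟨_, σ₀, |m| / 2 + 1, by positivity,
    hD.disjointCuspNeighborhoods hT (fun e => (hs e).le) σ₀, hD.globalDelaunay hT hs σ₀⟩

end LocallyDelaunay

theorem IsIdealDelaunay.exists_horoForm_eq (h : IsIdealDelaunay lam) (t : T) :
    ∃ (σ : IdealTriangle lam) (c : UpperHalfPlane) (ρ : ℝ), σ.tri = t ∧ 0 < ρ ∧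
      (∀ k, Hyp.horoForm c (σ.vec k) = ρ) ∧
        ∀ τ k, IsLift σ τ → ρ ≤ Hyp.horoForm c (τ.vec k) := by
  obtain ⟨D, σ₀, s, -, hdisj, hglobal⟩ := h
  obtain ⟨σ, hσ, rfl⟩ := exists_isLift_tri_eq σ₀ t
  obtain ⟨c, r, hr, htouch, hout⟩ := hglobal σ hσ
  have hface {τ : IdealTriangle lam} (k : Fin 3) (hτ : SameFace D σ τ) :
      Hyp.horoForm c (τ.vec k) = Real.exp (r - s) :=
    (Hyp.signedDist_eq_iff c (τ.vec_ne_zero k) _).1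
      ((htouch τ k hτ).signedDist_eq (τ.vec_ne_zero k) hr)
  refine ⟨σ, c, Real.exp (r - s), rfl, Real.exp_pos _, fun k => hface k .refl, fun τ k hτ => ?_⟩
  by_cases hmem : Hyp.horocycle (τ.vec k) s ∈ faceHorocycles D σ s
  · obtain ⟨ρ, l, hρ, heq⟩ := hmem
    rcases Hyp.eq_or_eq_neg_of_horocycle_eq (τ.vec_ne_zero k) (ρ.vec_ne_zero l) heq with hl | hl
    · rw [← hface l hρ, hl]
    · rw [← hface l hρ, hl, Hyp.horoForm_neg]
  · have hdist : r - s < Hyp.signedDist (τ.vec k) c := by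
      refine (Hyp.lt_or_lt_of_disjoint_sphere_horocycle (τ.vec_ne_zero k)
        (hout _ ⟨τ, k, hσ.trans hτ, rfl⟩ hmem)).resolve_right (not_lt.2 ?_)
      refine Hyp.le_signedDist_of_disjoint_horodisk (σ.vec_ne_zero 0) (τ.vec_ne_zero k) hr.le
        ((htouch σ 0 .refl).signedDist_eq (σ.vec_ne_zero 0) hr)
        (hdisj σ 0 τ k hσ (hσ.trans hτ) fun heq => hmem ⟨σ, 0, .refl, heq.symm⟩)
    exact ((Real.lt_log_iff_exp_lt (Hyp.horoForm_pos c (τ.vec_ne_zero k))).1 hdist).le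

theorem IsIdealDelaunay.triangleInequalities (h : IsIdealDelaunay lam) :
    TriangleInequalities (ell lam) := by
  intro t
  obtain ⟨σ, c, ρ, rfl, hρ, hσ, -⟩ := h.exists_horoForm_eq t
  refine σ.ell_lt_of_circumForm_pos fun w hw => pos_of_mul_pos_right (a := ρ) ?_ hρ.le
  exact σ.horoForm_eq_mul_circumForm hσ w ▸ Hyp.horoForm_pos c hw

theorem IsIdealDelaunay.locallyDelaunay (h : IsIdealDelaunay lam) :
    LocallyDelaunay (ell lam) := by
  rintro ⟨t, i⟩
  obtain ⟨σ, c, ρ, rfl, hρ, hσ, hle⟩ := h.exists_horoForm_eq t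
  obtain ⟨τ, j, hτ⟩ := σ.exists_adjAt i
  have hone : τ.circumForm (τ.vec j) ≤ σ.circumForm (τ.vec j) := by
    have := hle τ j (.single ⟨i, hτ.adj⟩)
    rw [σ.horoForm_eq_mul_circumForm hσ] at this
    rw [circumForm_vec]
    exact (le_mul_iff_one_le_right hρ).1 this
  have hneg := τ.sideProd_vec_self_neg j
  rw [hτ.sideProd_eq, neg_lt_zero] at hneg
  have hsub := hτ.ell_sq_mul_circumForm_sub (τ.vec j)
  have := mul_nonneg (sq_nonneg (ell lam (Δ.edge σ.tri i))) (sub_nonneg.2 hone)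
  rw [hsub] at this
  linarith [nonneg_of_mul_nonneg_left this hneg]

end Triangulation

/-! ### Circles and orientation in the euclidean plane -/

namespace Euclid

open EuclideanGeometry

/-- Twice the signed area of the triangle `p`, `q`, `x`. -/
def orient (p q x : ℂ) : ℝ := ((starRingEnd ℂ) (q - p) * (x - p)).im

theorem orient_eq (p q x : ℂ) :
    orient p q x = (q.re - p.re) * (x.im - p.im) - (q.im - p.im) * (x.re - p.re) := by
  simp only [orient, Complex.mul_im, Complex.conj_re, Complex.conj_im, Complex.sub_re,
    Complex.sub_im]
  ring

theorem inner_eq (z w : ℂ) : inner ℝ z w = z.re * w.re + z.im * w.im := by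
  rw [Complex.inner, Complex.mul_re, Complex.conj_re, Complex.conj_im]; ring

theorem orient_swap (p q x : ℂ) : orient q p x = -orient p q x := by
  rw [orient_eq, orient_eq]; ring

theorem orient_rotate (p q x : ℂ) : orient q x p = orient p q x := by
  rw [orient_eq, orient_eq]; ring

theorem orient_smul_sub (i k m w : ℂ) :
    orient i k m • (w - m) = orient k m w • (i - m) + orient m i w • (k - m) := by
  apply Complex.ext <;>
    simp only [orient_eq, Complex.add_re, Complex.add_im, Complex.smul_re, Complex.smul_im,
      Complex.sub_re, Complex.sub_im, smul_eq_mul] <;> ring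

theorem orient_sq_add_inner_sq (a b p : ℂ) :
    orient a b p ^ 2 + inner ℝ (a - p) (b - p) ^ 2 = (dist a p * dist b p) ^ 2 := by
  rw [← orient_rotate, ← orient_rotate, orient, Complex.inner, mul_comm (b - p),
    dist_eq_norm, dist_eq_norm, ← Complex.norm_conj (a - p), ← norm_mul,
    ← Complex.normSq_eq_norm_sq, Complex.normSq_apply]
  ring

theorem inner_sub_sub_eq (a b p : ℂ) :
    inner ℝ (a - p) (b - p) = (dist a p ^ 2 + dist b p ^ 2 - dist a b ^ 2) / 2 := by
  rw [real_inner_eq_norm_mul_self_add_norm_mul_self_sub_norm_sub_mul_self_div_two,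
    sub_sub_sub_cancel_right]
  simp only [dist_eq_norm, sq]

theorem eq_of_dist_eq_of_orient_pos {a b p p' : ℂ} (ha : dist p a = dist p' a)
    (hb : dist p b = dist p' b) (h : 0 < orient a b p) (h' : 0 < orient a b p') : p = p' := by
  have hinner : inner ℝ (b - a) (p - a) = inner ℝ (b - a) (p' - a) := by
    rw [inner_sub_sub_eq, inner_sub_sub_eq, ha, dist_comm b p, hb, dist_comm p' b]
  have horient : orient a b p = orient a b p' := by
    rw [← sq_eq_sq₀ h.le h'.le, ← orient_rotate a, ← orient_rotate a]
    have hp := orient_sq_add_inner_sq b p a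
    have hp' := orient_sq_add_inner_sq b p' a
    rw [hinner, ha] at hp
    linarith
  have hab : (starRingEnd ℂ) (b - a) ≠ 0 := fun h0 => h.ne' (by simp [orient, h0])
  rw [Complex.inner, Complex.inner, mul_comm, mul_comm (p' - a)] at hinner
  exact sub_left_injective (mul_left_cancel₀ hab (Complex.ext hinner horient))

theorem exists_dist_eq_of_orient_pos {p q : ℂ} {b c : ℝ} (hb : 0 ≤ b) (hc : 0 ≤ c)
    (h : (dist p q ^ 2 + c ^ 2 - b ^ 2) ^ 2 < (2 * dist p q * c) ^ 2) :
    ∃ x, dist x p = c ∧ dist q x = b ∧ 0 < orient p q x := by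
  set s := (dist p q ^ 2 + c ^ 2 - b ^ 2) / 2 with hs
  have hsq : 0 < (dist p q * c) ^ 2 - s ^ 2 := by linear_combination h / 4
  have hpq : p ≠ q := by
    rintro rfl
    rw [dist_self, zero_mul] at hsq
    linarith [sq_nonneg s]
  set v := (starRingEnd ℂ) (q - p) with hv
  have hv0 : v ≠ 0 := (map_ne_zero _).2 (sub_ne_zero.2 hpq.symm)
  have hnorm : ‖v‖ = dist p q := by rw [hv, Complex.norm_conj, dist_comm, dist_eq_norm]
  set z : ℂ := ⟨s, √((dist p q * c) ^ 2 - s ^ 2)⟩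
  have hz : ‖z‖ = dist p q * c := by
    rw [← sq_eq_sq₀ (norm_nonneg _) (by positivity), ← Complex.normSq_eq_norm_sq,
      Complex.normSq_apply, Real.mul_self_sqrt hsq.le]
    ring
  have hvz : v * (p + z / v - p) = z := by field_simp; ring
  have hp : dist (p + z / v) p = c := by
    rw [dist_eq_norm, add_sub_cancel_left, norm_div, hz, hnorm,
      mul_div_cancel_left₀ _ (dist_pos.2 hpq).ne']
  refine ⟨p + z / v, hp, ?_, ?_⟩
  · have hinner := inner_sub_sub_eq q (p + z / v) p
    rw [Complex.inner, mul_comm, hvz, hp, dist_comm q p] at hinner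
    rw [← sq_eq_sq₀ dist_nonneg hb]
    linarith
  · rw [orient, hvz]
    exact Real.sqrt_pos.2 hsq

theorem power_eq_zero_of_mem {S : Sphere ℂ} {z : ℂ} (hz : z ∈ S) : S.power z = 0 := by
  rw [Sphere.power, mem_sphere.1 hz, sub_self]

theorem mem_ball_iff_power_neg {S : Sphere ℂ} {p : ℂ} (hp : p ∈ S) {z : ℂ} :
    z ∈ Metric.ball S.center S.radius ↔ S.power z < 0 :=
  (Sphere.power_neg_iff_dist_center_lt_radius (Sphere.radius_nonneg_of_mem hp)).symm

theorem power_mul_orient {S : Sphere ℂ} {a b p : ℂ} (ha : a ∈ S) (hb : b ∈ S) (hp : p ∈ S)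
    (q : ℂ) : S.power q * orient a b p =
      inner ℝ (a - q) (b - q) * orient a b p - inner ℝ (a - p) (b - p) * orient a b q := by
  have hpower (z : ℂ) : S.power z =
      (z.re - S.center.re) ^ 2 + (z.im - S.center.im) ^ 2 - S.radius ^ 2 := by
    rw [Sphere.power, Complex.dist_eq, ← Complex.normSq_eq_norm_sq, Complex.normSq_apply,
      Complex.sub_re, Complex.sub_im]
    ring
  have hinterpolation : S.power q * orient a b p -
      (inner ℝ (a - q) (b - q) * orient a b p - inner ℝ (a - p) (b - p) * orient a b q) =
        S.power a * orient q b p + S.power b * orient a q p + S.power p * orient a b q := by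
    simp only [hpower, inner_eq, orient_eq, Complex.sub_re, Complex.sub_im]
    ring
  rw [power_eq_zero_of_mem ha, power_eq_zero_of_mem hb, power_eq_zero_of_mem hp] at hinterpolation
  linarith

/-- The function `x ↦ ⟪x - m, m - c⟫` is negative on the ball, hence on both sides of the triangle
at `m`, and so it is nonnegative on the opposite sector. -/
theorem not_mem_ball_of_orient_nonpos {i k m y z w c : ℂ} {r : ℝ} (ho : 0 < orient i k m)
    (hm : m ∉ Metric.ball c r) (hy : y ∈ segment ℝ m i) (hyB : y ∈ Metric.ball c r)
    (hz : z ∈ segment ℝ m k) (hzB : z ∈ Metric.ball c r) (h1 : orient k m w ≤ 0)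
    (h2 : orient m i w ≤ 0) : w ∉ Metric.ball c r := by
  have hball {x : ℂ} (hx : x ∈ Metric.ball c r) : inner ℝ (x - m) (m - c) < 0 := by
    have hlt : ‖x - c‖ < ‖m - c‖ := by
      simpa only [dist_eq_norm] using (Metric.mem_ball.1 hx).trans_le (not_lt.1 hm)
    have hle := real_inner_le_norm (x - c) (m - c)
    rw [← sub_sub_sub_cancel_right x m c, inner_sub_left, real_inner_self_eq_norm_mul_norm]
    have := mul_lt_mul_of_pos_right hlt ((norm_nonneg _).trans_lt hlt)
    linarith
  have hside {x v : ℂ} (hx : x ∈ segment ℝ m v) (hxB : x ∈ Metric.ball c r) :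
      inner ℝ (v - m) (m - c) < 0 := by
    rw [segment_eq_image'] at hx
    obtain ⟨s, ⟨hs, -⟩, rfl⟩ := hx
    have := hball hxB
    rw [add_sub_cancel_left, real_inner_smul_left] at this
    exact neg_of_mul_neg_right this hs
  intro hw
  have hsector := congrArg (inner ℝ · (m - c)) (orient_smul_sub i k m w)
  simp only [inner_add_left, real_inner_smul_left] at hsector
  have := mul_neg_of_pos_of_neg ho (hball hw)
  have := mul_nonneg_of_nonpos_of_nonpos h1 (hside hy hyB).le
  have := mul_nonneg_of_nonpos_of_nonpos h2 (hside hz hzB).le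
  linarith

end Euclid

/-! ### Euclidean triangles and their circumcircles -/

namespace Triangulation

variable {T : Type*} {Δ : Triangulation T} {ℓ : Δ.Edge → ℝ}

namespace EuclideanTriangle

open Euclid EuclideanGeometry

attribute [ext] EuclideanTriangle

theorem dist_pt_add_two (σ : EuclideanTriangle ℓ) (i : Fin 3) :
    dist (σ.pt (i + 2)) (σ.pt i) = ℓ (Δ.edge σ.tri (i + 1)) := by
  simpa only [fin_three_add_add] using σ.dist_eq (i + 1)

theorem dist_pt_add_one (σ : EuclideanTriangle ℓ) (i : Fin 3) :
    dist (σ.pt i) (σ.pt (i + 1)) = ℓ (Δ.edge σ.tri (i + 2)) := by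
  simpa only [fin_three_add_add] using σ.dist_eq (i + 2)

theorem orient_pt_pos_iff (f : Fin 3 → ℂ) (i : Fin 3) :
    0 < orient (f (i + 1)) (f (i + 2)) (f i) ↔
      0 < ((starRingEnd ℂ) (f 1 - f 0) * (f 2 - f 0)).im := by
  change _ ↔ 0 < orient (f 0) (f 1) (f 2)
  fin_cases i
  · exact iff_of_eq (congrArg (0 < ·) (orient_rotate (f 0) (f 1) (f 2)))
  · exact iff_of_eq (congrArg (0 < ·) (orient_rotate (f 2) (f 0) (f 1)).symm)
  · rfl

theorem orient_pos (σ : EuclideanTriangle ℓ) (i : Fin 3) :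
    0 < orient (σ.pt (i + 1)) (σ.pt (i + 2)) (σ.pt i) :=
  (orient_pt_pos_iff σ.pt i).2 σ.oriented

theorem pt_ne (σ : EuclideanTriangle ℓ) (i : Fin 3) : σ.pt (i + 1) ≠ σ.pt (i + 2) := fun h =>
  (σ.orient_pos i).ne' (by simp [orient, h])

theorem length_pos (σ : EuclideanTriangle ℓ) (i : Fin 3) : 0 < ℓ (Δ.edge σ.tri i) :=
  σ.dist_eq i ▸ dist_pos.2 (σ.pt_ne i)

theorem affineIndependent (σ : EuclideanTriangle ℓ) : AffineIndependent ℝ σ.pt := by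
  rw [affineIndependent_iff_not_collinear, collinear_iff_of_mem (Set.mem_range_self 0)]
  rintro ⟨v, hv⟩
  obtain ⟨r, hr⟩ := hv _ (Set.mem_range_self 1)
  obtain ⟨s, hs⟩ := hv _ (Set.mem_range_self 2)
  refine σ.oriented.ne' ?_
  simp only [hr, hs, vadd_eq_add, Complex.real_smul, add_sub_cancel_right, map_mul,
    Complex.conj_ofReal, Complex.mul_im, Complex.mul_re, Complex.ofReal_re, Complex.ofReal_im,
    Complex.conj_re, Complex.conj_im]
  ring

/-- The circumcircle of `σ`. -/
noncomputable def circumsphere (σ : EuclideanTriangle ℓ) : Sphere ℂ :=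
  (⟨σ.pt, σ.affineIndependent⟩ : Affine.Simplex ℝ ℂ 2).circumsphere

theorem pt_mem_circumsphere (σ : EuclideanTriangle ℓ) (k : Fin 3) : σ.pt k ∈ σ.circumsphere :=
  Affine.Simplex.mem_circumsphere ⟨σ.pt, σ.affineIndependent⟩ k

/-- The cotangent of the angle of `σ` at the corner `i`. -/
noncomputable def cornerCot (σ : EuclideanTriangle ℓ) (i : Fin 3) : ℝ :=
  inner ℝ (σ.pt (i + 1) - σ.pt i) (σ.pt (i + 2) - σ.pt i) /
    orient (σ.pt (i + 1)) (σ.pt (i + 2)) (σ.pt i)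

theorem power_eq (σ : EuclideanTriangle ℓ) {S : Sphere ℂ} (hS : ∀ k, σ.pt k ∈ S) (i : Fin 3)
    (z : ℂ) : S.power z = inner ℝ (σ.pt (i + 1) - z) (σ.pt (i + 2) - z) -
      σ.cornerCot i * orient (σ.pt (i + 1)) (σ.pt (i + 2)) z := by
  have hpos := σ.orient_pos i
  refine mul_right_cancel₀ hpos.ne' ?_
  rw [power_mul_orient (hS _) (hS _) (hS i), cornerCot]
  field_simp

theorem sin_arctan_cornerCot (σ : EuclideanTriangle ℓ) (i : Fin 3) :
    Real.sin (Real.arctan (σ.cornerCot i)) = cornerCos ℓ (σ.tri, i) := by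
  have hpos := σ.orient_pos i
  have h1 := σ.length_pos (i + 1)
  have h2 := σ.length_pos (i + 2)
  have hsq := orient_sq_add_inner_sq (σ.pt (i + 1)) (σ.pt (i + 2)) (σ.pt i)
  have hinner := inner_sub_sub_eq (σ.pt (i + 1)) (σ.pt (i + 2)) (σ.pt i)
  rw [dist_pt_add_two, dist_comm, dist_pt_add_one] at hsq hinner
  rw [σ.dist_eq] at hinner
  have hsqrt : √(1 + σ.cornerCot i ^ 2) = ℓ (Δ.edge σ.tri (i + 2)) * ℓ (Δ.edge σ.tri (i + 1)) /
      orient (σ.pt (i + 1)) (σ.pt (i + 2)) (σ.pt i) := by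
    rw [Real.sqrt_eq_iff_eq_sq (by positivity) (by positivity), div_pow, ← hsq, cornerCot]
    field_simp
  rw [Real.sin_arctan, hsqrt, cornerCot, cornerCos, div_div_div_cancel_right₀ hpos.ne', hinner]
  field_simp
  ring

theorem neg_one_lt_cornerCos (σ : EuclideanTriangle ℓ) (i : Fin 3) :
    -1 < cornerCos ℓ (σ.tri, i) := by
  rw [← sin_arctan_cornerCot]
  exact (Real.neg_one_le_sin _).trans_lt (Real.sin_arctan_strictMono (sub_one_lt _))

/-- The side `i` of `σ` is attached to the side `j` of `τ`. -/
def AdjAt (σ : EuclideanTriangle ℓ) (i : Fin 3) (τ : EuclideanTriangle ℓ) (j : Fin 3) : Prop :=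
  Δ.glue (σ.tri, i) = (τ.tri, j) ∧
    τ.pt (j + 1) = σ.pt (i + 2) ∧ τ.pt (j + 2) = σ.pt (i + 1)

theorem ext_side {σ τ : EuclideanTriangle ℓ} (htri : σ.tri = τ.tri) (i : Fin 3)
    (h1 : σ.pt (i + 1) = τ.pt (i + 1)) (h2 : σ.pt (i + 2) = τ.pt (i + 2)) : σ = τ := by
  refine EuclideanTriangle.ext htri (funext ((forall_fin_three i).2 ⟨?_, h1, h2⟩))
  refine eq_of_dist_eq_of_orient_pos ?_ ?_ (σ.orient_pos i) (h1 ▸ h2 ▸ τ.orient_pos i)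
  · rw [dist_pt_add_one, h1, dist_pt_add_one, htri]
  · rw [dist_comm, dist_pt_add_two, h2, dist_comm, dist_pt_add_two, htri]

theorem AdjAt.symm {σ τ : EuclideanTriangle ℓ} {i j : Fin 3} (h : σ.AdjAt i τ j) :
    τ.AdjAt j σ i :=
  ⟨by rw [← h.1, Δ.glue_glue], h.2.2.symm, h.2.1.symm⟩

theorem AdjAt.eq_of_adjAt {σ τ ρ : EuclideanTriangle ℓ} {i j k : Fin 3} (h : σ.AdjAt i τ j)
    (h' : τ.AdjAt j ρ k) : ρ = σ := by
  obtain ⟨htri, rfl⟩ := Prod.ext_iff.1 (h'.1.symm.trans h.symm.1)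
  exact ext_side htri k (h'.2.1.trans h.symm.2.1.symm) (h'.2.2.trans h.symm.2.2.symm)

theorem AdjAt.orient_eq_neg {σ τ : EuclideanTriangle ℓ} {i j : Fin 3} (h : σ.AdjAt i τ j)
    (z : ℂ) : orient (τ.pt (j + 1)) (τ.pt (j + 2)) z =
      -orient (σ.pt (i + 1)) (σ.pt (i + 2)) z := by
  rw [h.2.1, h.2.2, orient_swap]

theorem AdjAt.power_sub_power {σ τ : EuclideanTriangle ℓ} {i j : Fin 3} (h : σ.AdjAt i τ j)
    {S S' : Sphere ℂ} (hS : ∀ k, σ.pt k ∈ S) (hS' : ∀ k, τ.pt k ∈ S') (z : ℂ) :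
    S'.power z - S.power z =
      (σ.cornerCot i + τ.cornerCot j) * orient (σ.pt (i + 1)) (σ.pt (i + 2)) z := by
  rw [σ.power_eq hS i, τ.power_eq hS' j, h.orient_eq_neg, h.2.1, h.2.2, real_inner_comm]
  ring

theorem AdjAt.cornerCot_add_nonneg_iff {σ τ : EuclideanTriangle ℓ} {i j : Fin 3}
    (h : σ.AdjAt i τ j) : 0 ≤ σ.cornerCot i + τ.cornerCot j ↔
      0 ≤ cornerCos ℓ (σ.tri, i) + cornerCos ℓ (Δ.glue (σ.tri, i)) := by
  rw [h.1, ← sin_arctan_cornerCot, ← sin_arctan_cornerCot, ← neg_le_iff_add_nonneg,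
    ← neg_le_iff_add_nonneg, ← Real.sin_neg, ← Real.arctan_neg,
    Real.sin_arctan_strictMono.le_iff_le]

theorem exists_tri_pt_eq (hT : TriangleInequalities ℓ) (t : T) (j : Fin 3) {p q : ℂ}
    (h : dist p q = ℓ (Δ.edge t j)) :
    ∃ τ : EuclideanTriangle ℓ, τ.tri = t ∧ τ.pt (j + 1) = p ∧ τ.pt (j + 2) = q := by
  have h0 := hT.pos (Δ.edge t j)
  have h1 := hT.pos (Δ.edge t (j + 1))
  have h2 := hT.pos (Δ.edge t (j + 2))
  have hlaw := two_mul_mul_cornerCos hT.pos t (j + 1)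
  simp only [fin_three_add_add] at hlaw
  obtain ⟨x, hxp, hqx, hx⟩ := exists_dist_eq_of_orient_pos (p := p) (q := q) h1.le h2.le (by
    rw [h, add_comm, ← hlaw, mul_pow, mul_right_comm]
    exact mul_lt_of_lt_one_right (by positivity) (hT.cornerCos_sq_lt_one t (j + 1)))
  obtain ⟨f, rfl, rfl, rfl⟩ := exists_fin_three j x p q
  refine ⟨⟨t, f, (forall_fin_three j).2 ?_, (orient_pt_pos_iff f j).1 hx⟩, rfl, rfl, rfl⟩
  simp only [fin_three_add_add]
  exact ⟨h, hqx, hxp⟩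

theorem exists_adjAt (hT : TriangleInequalities ℓ) (σ : EuclideanTriangle ℓ) (i : Fin 3) :
    ∃ τ, ∃ j, σ.AdjAt i τ j := by
  obtain ⟨τ, htri, h1, h2⟩ := exists_tri_pt_eq hT (Δ.glue (σ.tri, i)).1 (Δ.glue (σ.tri, i)).2
    (p := σ.pt (i + 2)) (q := σ.pt (i + 1)) (by
      rw [edge_eq_of_glue rfl, dist_comm, σ.dist_eq])
  exact ⟨τ, _, by rw [htri], h1, h2⟩

end EuclideanTriangle

/-! ### Euclidean Delaunay triangulations -/

namespace EuclideanTriangle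

open Euclid EuclideanGeometry

/-- The side `i` of `σ` meets the open disk with center `c` and radius `r`. -/
def SideMeets (σ : EuclideanTriangle ℓ) (i : Fin 3) (c : ℂ) (r : ℝ) : Prop :=
  (segment ℝ (σ.pt (i + 1)) (σ.pt (i + 2)) ∩ Metric.ball c r).Nonempty

theorem AdjAt.sideMeets {σ τ : EuclideanTriangle ℓ} {i j : Fin 3} (h : σ.AdjAt i τ j) {c : ℂ}
    {r : ℝ} (hi : σ.SideMeets i c r) : τ.SideMeets j c r := by
  rwa [SideMeets, h.2.1, h.2.2, segment_symm]

theorem sideMeets_of_mem_sphere (σ : EuclideanTriangle ℓ) {S : Sphere ℂ}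
    (hS : ∀ k, σ.pt k ∈ S) (i : Fin 3) : σ.SideMeets i S.center S.radius :=
  ⟨midpoint ℝ _ _, midpoint_mem_segment _ _, openSegment_subset_ball_of_ne
    (Metric.sphere_subset_closedBall (hS _)) (Metric.sphere_subset_closedBall (hS _)) (σ.pt_ne i)
    (midpoint_mem_openSegment _ _)⟩

/-- The point `z` does not lie behind the side `o`, as seen by somebody who has entered `τ` through
this side. -/
def LiesAhead (τ : EuclideanTriangle ℓ) (o : Option (Fin 3)) (z : ℂ) : Prop :=
  ∀ j ∈ o, 0 ≤ orient (τ.pt (j + 1)) (τ.pt (j + 2)) z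

theorem orient_nonneg_of_orient_nonpos (σ : EuclideanTriangle ℓ) {i k : Fin 3} (hki : k ≠ i)
    {c z : ℂ} {r : ℝ} (hpt : ∀ k, σ.pt k ∉ Metric.ball c r) (hi : σ.SideMeets i c r)
    (hk : σ.SideMeets k c r) (hz : z ∈ Metric.ball c r)
    (hle : orient (σ.pt (i + 1)) (σ.pt (i + 2)) z ≤ 0) :
    0 ≤ orient (σ.pt (k + 1)) (σ.pt (k + 2)) z := by
  obtain ⟨x, hx, hxball⟩ := hi
  have hpos := σ.orient_pos i
  revert k
  simp only [forall_fin_three i, SideMeets, fin_three_add_add, ne_eq, not_true_eq_false,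
    IsEmpty.forall_iff, true_and]
  constructor <;> rintro - ⟨y, hy, hyball⟩ <;> by_contra! hlt
  · rw [segment_symm] at hx
    refine not_mem_ball_of_orient_nonpos ?_ (hpt (i + 2)) hy hyball hx hxball hle hlt.le hz
    rwa [orient_rotate] at hpos
  · rw [segment_symm] at hy
    refine not_mem_ball_of_orient_nonpos ?_ (hpt (i + 1)) hx hxball hy hyball hlt.le hle hz
    rwa [orient_rotate, orient_rotate] at hpos

end EuclideanTriangle

open Euclid EuclideanGeometry EuclideanTriangle

theorem UnfoldsOver.exists_reducedPath {c : ℂ} {r : ℝ} {σ τ : EuclideanTriangle ℓ}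
    (h : UnfoldsOver c r σ τ) :
    ∃ o, ReducedPath (fun a i b j => a.SideMeets i c r ∧ a.AdjAt i b j) σ τ o := by
  have hpath : Relation.ReflTransGen
      (fun a b => ∃ i j, EuclideanTriangle.SideMeets a i c r ∧ a.AdjAt i b j) σ τ :=
    Relation.ReflTransGen.mono (fun _ _ ⟨i, hi, j, hj⟩ => ⟨i, j, hi, hj⟩) _ _ h
  obtain ⟨_, o, rfl, hr⟩ := ReducedPath.exists_of_reflTransGen eq_equivalence
    (by rintro x _ i y j rfl hxy; exact ⟨y, rfl, hxy⟩)
    (fun h1 h2 => (h1.2.eq_of_adjAt h2.2).symm) hpath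
  exact ⟨o, hr⟩

namespace LocallyDelaunay

theorem power_circumsphere_le (hD : LocallyDelaunay ℓ) {σ τ : EuclideanTriangle ℓ} {i j : Fin 3}
    (h : σ.AdjAt i τ j) {z : ℂ} (hz : τ.LiesAhead (some j) z) :
    τ.circumsphere.power z ≤ σ.circumsphere.power z := by
  have := mul_nonneg (h.cornerCot_add_nonneg_iff.2 (hD _)) (hz j rfl)
  have := h.power_sub_power σ.pt_mem_circumsphere τ.pt_mem_circumsphere z
  rw [h.orient_eq_neg] at *
  linarith

/-- The three claims are proved together: the circumdisks shrink because the vertices passed so far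
lie outside the circumdisk of `σ`, and the next vertex lies outside because they shrink. -/
theorem power_circumsphere_le_of_reducedPath (hD : LocallyDelaunay ℓ) {σ τ : EuclideanTriangle ℓ}
    {o : Option (Fin 3)} (h : ReducedPath (fun a i b j =>
      a.SideMeets i σ.circumsphere.center σ.circumsphere.radius ∧ a.AdjAt i b j) σ τ o) :
    (∀ j ∈ o, τ.SideMeets j σ.circumsphere.center σ.circumsphere.radius) ∧
    (∀ k, 0 ≤ σ.circumsphere.power (τ.pt k)) ∧
    ∀ z, σ.circumsphere.power z < 0 → τ.LiesAhead o z →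
      τ.circumsphere.power z ≤ σ.circumsphere.power z := by
  induction h with
  | base => exact ⟨by simp, fun k => (power_eq_zero_of_mem (σ.pt_mem_circumsphere k)).ge,
      fun _ _ _ => le_rfl⟩
  | @step x o i y j _ ho hxy ih =>
    obtain ⟨hin, hpt, hle⟩ := ih
    obtain ⟨hout, hadj⟩ := hxy
    have hball {z : ℂ} : z ∈ Metric.ball _ _ ↔ _ :=
      mem_ball_iff_power_neg (σ.pt_mem_circumsphere 0)
    have hpt' (k : Fin 3) : x.pt k ∉ Metric.ball _ _ := fun hk => (hpt k).not_gt (hball.1 hk)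
    have hle' (z : ℂ) (hz : σ.circumsphere.power z < 0) (hahead : y.LiesAhead (some j) z) :
        y.circumsphere.power z ≤ σ.circumsphere.power z := by
      refine (hD.power_circumsphere_le hadj hahead).trans (hle z hz fun k hk => ?_)
      refine x.orient_nonneg_of_orient_nonpos (fun hki => ho (hk.trans (congrArg some hki))) hpt'
        hout (hin k hk) (hball.2 hz) ?_
      have := hahead j rfl
      rw [hadj.orient_eq_neg] at this
      linarith
    refine ⟨fun k hk => Option.some_inj.1 hk ▸ hadj.sideMeets hout, (forall_fin_three j).2 ?_, hle'⟩
    refine ⟨not_lt.1 fun hneg => ?_, hadj.2.1 ▸ hpt _, hadj.2.2 ▸ hpt _⟩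
    have := hle' _ hneg (by rintro _ ⟨⟩; exact (y.orient_pos j).le)
    rw [power_eq_zero_of_mem (y.pt_mem_circumsphere j)] at this
    linarith

theorem isEuclideanDelaunay (hD : LocallyDelaunay ℓ) (hT : TriangleInequalities ℓ) :
    IsEuclideanDelaunay ℓ := by
  intro t
  obtain ⟨σ, hσ, -⟩ := exists_tri_pt_eq hT t 0 (p := 0) (q := (ℓ (Δ.edge t 0) : ℂ)) (by
    rw [dist_comm, dist_zero_right, Complex.norm_of_nonneg (hT.pos _).le])
  refine ⟨σ, hσ, _, _, σ.pt_mem_circumsphere, fun τ k hτ => ?_⟩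
  obtain ⟨o, ho⟩ := hτ.exists_reducedPath
  rw [mem_ball_iff_power_neg (σ.pt_mem_circumsphere 0), not_lt]
  exact (hD.power_circumsphere_le_of_reducedPath ho).2.1 k

end LocallyDelaunay

theorem IsEuclideanDelaunay.triangleInequalities (h : IsEuclideanDelaunay ℓ) :
    TriangleInequalities ℓ := by
  intro t i
  obtain ⟨σ, rfl, -⟩ := h t
  refine (neg_one_lt_cornerCos_iff ?_ _ _).1 (σ.neg_one_lt_cornerCos i)
  rintro ⟨t', k⟩
  obtain ⟨τ, rfl, -⟩ := h t'
  exact τ.length_pos k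

theorem IsEuclideanDelaunay.locallyDelaunay (h : IsEuclideanDelaunay ℓ) : LocallyDelaunay ℓ := by
  rintro ⟨t, i⟩
  obtain ⟨σ, rfl, c, r, hσ, hempty⟩ := h t
  obtain ⟨τ, j, hτ⟩ := σ.exists_adjAt h.triangleInequalities i
  have hS (k : Fin 3) : σ.pt k ∈ (⟨c, r⟩ : Sphere ℂ) := hσ k
  have hout : 0 ≤ (⟨c, r⟩ : Sphere ℂ).power (τ.pt j) := by
    have := hempty τ j (.single ⟨i, σ.sideMeets_of_mem_sphere hS i, j, hτ⟩)
    exact not_lt.1 (this ∘ (mem_ball_iff_power_neg (hS 0)).2)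
  have hsub := hτ.power_sub_power hS τ.pt_mem_circumsphere (τ.pt j)
  rw [power_eq_zero_of_mem (τ.pt_mem_circumsphere j)] at hsub
  rw [← hτ.cornerCot_add_nonneg_iff]
  have hpos := τ.orient_pos j
  rw [hτ.orient_eq_neg] at hpos
  refine nonneg_of_mul_nonneg_left (b := -orient (σ.pt (i + 1)) (σ.pt (i + 2)) (τ.pt j)) ?_ hpos
  linarith

end Triangulation

theorem mainTheorem11_general {T : Type*} [Nonempty T] (Δ : Triangulation T) (lam : Δ.Edge → ℝ) :
    (Triangulation.IsIdealDelaunay lam →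
      Triangulation.TriangleInequalities (Triangulation.ell lam) ∧
        Triangulation.IsEuclideanDelaunay (Triangulation.ell lam)) ∧
    (BddBelow (Set.range lam) → Triangulation.IsEuclideanDelaunay (Triangulation.ell lam) →
      Triangulation.IsIdealDelaunay lam) :=
  ⟨fun h => ⟨h.triangleInequalities, h.locallyDelaunay.isEuclideanDelaunay h.triangleInequalities⟩,
    fun hlam h => h.locallyDelaunay.isIdealDelaunay h.triangleInequalities hlam⟩

theorem mainTheorem11 {T : Type*} [Finite T] [Nonempty T] (Δ : Triangulation T)
    (lam : Δ.Edge → ℝ) :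
    (Triangulation.IsIdealDelaunay lam →
      Triangulation.TriangleInequalities (Triangulation.ell lam) ∧
        Triangulation.IsEuclideanDelaunay (Triangulation.ell lam)) ∧
    (Triangulation.TriangleInequalities (Triangulation.ell lam) →
      Triangulation.IsEuclideanDelaunay (Triangulation.ell lam) →
        Triangulation.IsIdealDelaunay lam) := by
  have : Finite Δ.Edge := Finite.of_surjective (Quot.mk _) Quot.mk_surjective
  obtain ⟨hideal, heuclidean⟩ := mainTheorem11_general Δ lam
  exact ⟨hideal, fun _ => heuclidean (Set.finite_range lam).bddBelow⟩
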